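/- **Setting.** Let $E_\bullet:\ 0\to E_N\xrightarrow{f_N}\cdots\xrightarrow{f_1}E_0\to 0$ be a complex over $\mathbb P^n$ with $E_k=\bigoplus_{j=1}^{r_k}\mathcal O(-d_k^j)$, $d_k^j\in\mathbb Z$, with frame elements $e_{k,j}$, where $f_k=\sum_{ij}f_k^{ij}\,e_{k-1,i}\otimes e_{k,j}^*$ is a matrix of homogeneous forms with $\deg f_k^{ij}=d_k^j-d_{k-1}^i$. Let $F_k$ denote the same matrices on $\mathbb C^{n+1}$. Put $E_k=0$ for $k<0$ and $k>N$. All maps $f_k$, $F_k$ are odd: they anticommute with forms of odd degree, so that $f\cdot(\omega A)=(-1)^{\deg\omega}\omega\,(fA)$ for a form $\omega$ and a homomorphism $A$. **Forms on $\mathbb P^n_\zeta\times\mathbb P^n_z$.** Let $\eta=2\pi i\sum_{j=0}^n z_j\,\partial/\partial\zeta_j$, let $\delta_\eta$ be interior multiplication by $\eta$, and $\nabla_\eta=\delta_\eta-\bar\partial_\zeta$. For a line bundle $L=\mathcal O_\zeta(a)\otimes\mathcal O_z(b)$ let $\mathbf L^\nu(L)=\bigoplus_j\mathcal E_{j,j+\nu}(\mathcal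 O_\zeta(j)\otimes\mathcal O_z(-j)\otimes L)$, where $\mathcal E_{p,q}(\cdot)$ denotes smooth forms of bidegree $(p,q)$ in $\zeta$ and $(0,0)$ in $z$; the definition extends to direct sums of such bundles. Sections are written in homogeneous coordinates $\zeta,z\in\mathbb C^{n+1}\setminus\{0\}$. A *Hefer morphism* for a complex $E_\bullet$ as above is a family $H=(H_k^\ell)$ of smooth sections of $\mathbf L^{-k+\ell}(\mathrm{Hom}(E_{\zeta,k},E_{z,\ell}))$ that are holomorphic in $z$, such that $H_k^\ell=0$ for $k<\ell$, the component of bidegree $(0,0)$ of $H_\ell^\ell$ is the identity $I_{E_\ell}$ on the diagonal, and $$\nabla_\eta H_k^\ell=H_{k-1}^\ell f_k(\zeta)-f_{\ell+1}(z)H_k^{\ell+1}.$$ **Polynomial Hefer forms.** Let $h_k^\ell=\sum_{ij}(h_k^\ell)_{ij}\,e_{\ell,i}\otimes e_{k,j}^*$ be matrices of forms in $dw_0,\dots,dw_n$ with polynomial coefficients in $(w,z)\in\mathbb C^{n+1}\times\mathbb C^{n+1}$ such that $h_k^\ell=0$ for $k<\ell$, $h_\ell^\ell=I$, the entry $(h_k^\ell)_{ij}$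 is for $k\ge\ell$ a $(k-\ell,0)$-form whose coefficients are homogeneous polynomials of degree $d_k^j-d_\ell^i-(k-\ell)$ (zero if this number is negative), and $$\delta_{z-w}h_k^\ell=h_{k-1}^\ell F_k(w)-F_{\ell+1}(z)h_k^{\ell+1},$$ where $\delta_{z-w}$ is interior multiplication by $2\pi i\sum_j(z_j-w_j)\,\partial/\partial w_j$. **Substitution.** Let $$\alpha=\frac{z\cdot\bar\zeta}{|\zeta|^2}-\bar\partial\frac{\bar\zeta\cdot d\zeta}{2\pi i|\zeta|^2},\qquad \gamma_j=d\zeta_j-\frac{\bar\zeta\cdot d\zeta}{|\zeta|^2}\,\zeta_j,$$ and let $\tau^*$ be the operation on forms in $dw$ with polynomial coefficients in $(w,z)$ that replaces $w$ by $\alpha\zeta$ and $dw_j$ by $\gamma_j$. **Proposition 4.4.** Let $\kappa$ be an integer with $\kappa\ge d_k^j$ for all $k$ and $j$, and define $$H_k^\ell=\sum_{ij}\tau^*(h_k^\ell)_{ij}\wedge\alpha^{\kappa-d_k^j}\,e_{\ell,i}\otimes e_{k,j}^*.$$ Then $(H_k^\ell)$ is a Hefer morphism for the complex $E_\bullet\otimes\mathcal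 O(\kappa)$. -/

import Mathlib

open scoped TensorProduct ContDiff

noncomputable section

namespace ProjHefer

/-! ### Smooth functions in homogeneous coordinates

Objects on `ℙⁿ_ζ × ℙⁿ_z` are described in homogeneous coordinates `(ζ, z)`, both nonzero vectors of
`ℂⁿ⁺¹`. -/

/-- The ambient space `ℂⁿ⁺¹_ζ × ℂⁿ⁺¹_z`. -/
abbrev Amb (n : ℕ) : Type := (Fin (n + 1) → ℂ) × (Fin (n + 1) → ℂ)

/-- The open set of pairs of nonzero vectors. -/
def dom (n : ℕ) : Set (Amb n) := {p | p.1 ≠ 0 ∧ p.2 ≠ 0}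

/-- Extension by zero of a function on `dom n`. -/
def ext0 {n : ℕ} (f : dom n → ℂ) (p : Amb n) : ℂ :=
  open Classical in if h : p ∈ dom n then f ⟨p, h⟩ else 0

theorem ext0_of_mem {n : ℕ} (f : dom n → ℂ) {p : Amb n} (h : p ∈ dom n) :
    ext0 f p = f ⟨p, h⟩ := by
  simp [ext0, h]

theorem isOpen_dom (n : ℕ) : IsOpen (dom n) :=
  (isOpen_ne.preimage continuous_fst).inter (isOpen_ne.preimage continuous_snd)

/-- The `ℂ`-algebra of complex-valued functions on `dom n` that are smooth in the real sense. -/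
def Sm (n : ℕ) : Subalgebra ℂ (dom n → ℂ) where
  carrier := {f | ContDiffOn ℝ ∞ (ext0 f) (dom n)}
  mul_mem' {f g} hf hg := (ContDiffOn.mul hf hg).congr fun p hp => by
    simp [ext0_of_mem _ hp]
  add_mem' {f g} hf hg := (ContDiffOn.add hf hg).congr fun p hp => by
    simp [ext0_of_mem _ hp]
  algebraMap_mem' c := (contDiffOn_const (c := c)).congr fun p hp => by
    simp [ext0_of_mem _ hp]

/-- The restriction to `dom n` of a function that is smooth there. -/
def Sm.mk {n : ℕ} (F : Amb n → ℂ) (hF : ContDiffOn ℝ ∞ F (dom n)) : Sm n :=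
  ⟨fun p => F p, hF.congr fun p hp => by simp [ext0_of_mem _ hp]⟩

theorem Sm.contDiffOn {n : ℕ} (f : Sm n) : ContDiffOn ℝ ∞ (ext0 f.1) (dom n) := f.2

theorem Sm.differentiableAt {n : ℕ} (f : Sm n) {p : Amb n} (hp : p ∈ dom n) :
    DifferentiableAt ℝ (ext0 f.1) p :=
  ((Sm.contDiffOn f).contDiffAt ((isOpen_dom n).mem_nhds hp)).differentiableAt (by simp)

theorem Sm.ext {n : ℕ} {f g : Sm n} (h : ∀ p : dom n, f.1 p = g.1 p) : f = g :=
  Subtype.ext (funext h)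

/-- The Wirtinger derivative `½ (∂_v + i ∂_{iv})` in the direction of the complex vector `v`; for
`v` a coordinate vector this is `∂/∂ζ̄_j` or `∂/∂z̄_j`. -/
def wirt {n : ℕ} (v : Amb n) : Sm n →ₗ[ℂ] Sm n where
  toFun f := Sm.mk
    (fun p => (1 / 2 : ℂ) * (fderiv ℝ (ext0 f.1) p v
      + Complex.I * fderiv ℝ (ext0 f.1) p (Complex.I • v)))
    (by
      have h : ContDiffOn ℝ ∞ (fderiv ℝ (ext0 f.1)) (dom n) :=
        (Sm.contDiffOn f).fderiv_of_isOpen (isOpen_dom n) (by simp)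
      exact contDiffOn_const.mul ((h.clm_apply contDiffOn_const).add
        (contDiffOn_const.mul (h.clm_apply contDiffOn_const))))
  map_add' f g := Sm.ext fun p => by
    have e : fderiv ℝ (ext0 (f + g).1) p.1
        = fderiv ℝ (ext0 f.1) p.1 + fderiv ℝ (ext0 g.1) p.1 := by
      rw [← fderiv_add (Sm.differentiableAt f p.2) (Sm.differentiableAt g p.2)]
      congr 1
      funext q
      by_cases hq : q ∈ dom n <;> simp [ext0, hq]
    change _ = (1 / 2 : ℂ) * _ + (1 / 2 : ℂ) * _
    simp only [Sm.mk]
    rw [e, add_apply, add_apply]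
    ring
  map_smul' c f := Sm.ext fun p => by
    have e : fderiv ℝ (ext0 (c • f).1) p.1 = c • fderiv ℝ (ext0 f.1) p.1 := by
      rw [← fderiv_const_smul (Sm.differentiableAt f p.2)]
      congr 1
      funext q
      by_cases hq : q ∈ dom n <;> simp [ext0, hq]
    change _ = c * ((1 / 2 : ℂ) * _)
    simp only [Sm.mk]
    rw [e, smul_apply, smul_apply, smul_eq_mul, smul_eq_mul]
    ring

/-- `∂/∂ζ̄_j`. -/
def dZetaBar {n : ℕ} (j : Fin (n + 1)) : Sm n →ₗ[ℂ] Sm n := wirt (Pi.single j 1, 0)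

/-- `∂/∂z̄_j`. -/
def dZBar {n : ℕ} (j : Fin (n + 1)) : Sm n →ₗ[ℂ] Sm n := wirt (0, Pi.single j 1)

/-- The coordinate function `ζ_j`. -/
def zeta {n : ℕ} (j : Fin (n + 1)) : Sm n :=
  Sm.mk (fun p => p.1 j) (by fun_prop)

/-- The coordinate function `z_j`. -/
def zed {n : ℕ} (j : Fin (n + 1)) : Sm n :=
  Sm.mk (fun p => p.2 j) (by fun_prop)

theorem contDiff_conj : ContDiff ℝ ∞ (fun x : ℂ => (starRingEnd ℂ) x) :=
  Complex.conjCLE.contDiff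

/-- The function `ζ̄_j`. -/
def zetaBar {n : ℕ} (j : Fin (n + 1)) : Sm n :=
  Sm.mk (fun p => (starRingEnd ℂ) (p.1 j))
    (contDiff_conj.comp_contDiffOn (by fun_prop))

/-- `|ζ|² = ∑ ζ_j ζ̄_j` as a complex number. -/
def nsq {n : ℕ} (p : Amb n) : ℂ := ∑ j, p.1 j * (starRingEnd ℂ) (p.1 j)

theorem nsq_ne_zero {n : ℕ} {p : Amb n} (hp : p ∈ dom n) : nsq p ≠ 0 := by
  intro h
  apply hp.1
  have h2 : ((∑ j, Complex.normSq (p.1 j) : ℝ) : ℂ) = 0 := by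
    rw [← h, nsq]
    push_cast
    exact Finset.sum_congr rfl fun j _ => (Complex.mul_conj _).symm
  have h3 : ∑ j, Complex.normSq (p.1 j) = 0 := by exact_mod_cast h2
  funext j
  have := (Finset.sum_eq_zero_iff_of_nonneg fun j _ => Complex.normSq_nonneg (p.1 j)).1 h3 j
    (Finset.mem_univ j)
  simpa using this

/-- The function `1 / |ζ|²`. -/
def invNsq {n : ℕ} : Sm n :=
  Sm.mk (fun p => (nsq p)⁻¹) (ContDiffOn.inv
    (ContDiffOn.sum fun j _ => ContDiffOn.mul (by fun_prop)
      (contDiff_conj.comp_contDiffOn (by fun_prop)))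
    fun _ hp => nsq_ne_zero hp)

/-! ### Forms

Smooth forms on `dom n` in the differentials `dζ_j`, `dζ̄_j` only (no `dz_j`, `dz̄_j`): the free
module over the smooth functions on the exterior algebra generated by these symbols. -/

/-- The space with basis `dζ_j = inl j` and `dζ̄_j = inr j`. -/
abbrev Cov (n : ℕ) : Type := (Fin (n + 1) ⊕ Fin (n + 1)) → ℂ

/-- The exterior algebra on `dζ_j`, `dζ̄_j`. -/
abbrev Lam (n : ℕ) : Type := ExteriorAlgebra ℂ (Cov n)

/-- Smooth forms on `dom n` in `dζ`, `dζ̄`; the multiplication is the wedge product. -/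
abbrev Form (n : ℕ) : Type := (Sm n) ⊗[ℂ] (Lam n)

instance (n : ℕ) : CommRing (Sm n) := inferInstance
instance (n : ℕ) : Ring (Form n) := Algebra.TensorProduct.instRing
instance (n : ℕ) : AddCommGroup (Form n) := (inferInstance : Ring (Form n)).toAddCommGroup
instance (n : ℕ) : Algebra (Sm n) (Form n) := Algebra.TensorProduct.leftAlgebra
instance (n : ℕ) : Algebra ℂ (Form n) := Algebra.TensorProduct.leftAlgebra
instance (n : ℕ) : Module (Sm n) (Form n) := Algebra.toModule
instance (n : ℕ) : Module ℂ (Form n) := Algebra.toModule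

/-- `dζ_j` as an element of the exterior algebra. -/
def eZeta {n : ℕ} (j : Fin (n + 1)) : Lam n := ExteriorAlgebra.ι ℂ (Pi.single (Sum.inl j) 1)

/-- `dζ̄_j` as an element of the exterior algebra. -/
def eZetaBar {n : ℕ} (j : Fin (n + 1)) : Lam n := ExteriorAlgebra.ι ℂ (Pi.single (Sum.inr j) 1)

/-- `∂̄ = ∂̄_ζ`. -/
def dbar {n : ℕ} : Form n →ₗ[ℂ] Form n :=
  ∑ j, TensorProduct.map (dZetaBar j) (LinearMap.mulLeft ℂ (eZetaBar j))

/-- Interior multiplication by `∂/∂ζ_j` (`i = inl j`) or by `∂/∂ζ̄_j` (`i = inr j`). -/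
def contr {n : ℕ} (i : Fin (n + 1) ⊕ Fin (n + 1)) : Form n →ₗ[Sm n] Form n :=
  (CliffordAlgebra.contractLeft (Q := (0 : QuadraticForm ℂ (Cov n)))
    (LinearMap.proj i)).baseChange (Sm n)

/-- `δ_η`, interior multiplication by `η = 2πi ∑ z_j ∂/∂ζ_j`. -/
def deltaEta {n : ℕ} : Form n →ₗ[ℂ] Form n :=
  (2 * Real.pi * Complex.I : ℂ) •
    ∑ j, ((zed j : Sm n) • (contr (Sum.inl j) : Form n →ₗ[Sm n] Form n)).restrictScalars ℂ

/-- `∇_η = δ_η - ∂̄`. -/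
def nablaEta {n : ℕ} : Form n →ₗ[ℂ] Form n := deltaEta - dbar

/-- Interior multiplication by the Euler field `∑ ζ_j ∂/∂ζ_j`. -/
def euler {n : ℕ} : Form n →ₗ[Sm n] Form n := ∑ j, (zeta j : Sm n) • (contr (Sum.inl j) : Form n →ₗ[Sm n] Form n)

/-- Interior multiplication by the conjugate Euler field `∑ ζ̄_j ∂/∂ζ̄_j`. -/
def eulerBar {n : ℕ} : Form n →ₗ[Sm n] Form n := ∑ j, (zetaBar j : Sm n) • (contr (Sum.inr j) : Form n →ₗ[Sm n] Form n)

/-- The map `(ζ, z) ↦ (s ζ, t z)`. -/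
def scale {n : ℕ} (s t : ℂˣ) (p : Amb n) : Amb n := ((s : ℂ) • p.1, (t : ℂ) • p.2)

theorem scale_mem {n : ℕ} (s t : ℂˣ) {p : Amb n} (hp : p ∈ dom n) : scale s t p ∈ dom n :=
  ⟨smul_ne_zero s.ne_zero hp.1, smul_ne_zero t.ne_zero hp.2⟩

/-- Composition of functions with `scale s t`. -/
def Sm.precomp {n : ℕ} (s t : ℂˣ) : Sm n →ₐ[ℂ] Sm n where
  toFun f := Sm.mk (fun p => ext0 f.1 (scale s t p))
    ((Sm.contDiffOn f).comp
      (ContDiff.contDiffOn (by unfold scale; fun_prop)) fun _ hp => scale_mem s t hp)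
  map_one' := Sm.ext fun p => by simp [Sm.mk, ext0_of_mem _ (scale_mem s t p.2)]
  map_mul' f g := Sm.ext fun p => by simp [Sm.mk, ext0_of_mem _ (scale_mem s t p.2)]
  map_zero' := Sm.ext fun p => by simp [Sm.mk, ext0_of_mem _ (scale_mem s t p.2)]
  map_add' f g := Sm.ext fun p => by simp [Sm.mk, ext0_of_mem _ (scale_mem s t p.2)]
  commutes' c := Sm.ext fun p => by simp [Sm.mk, ext0_of_mem _ (scale_mem s t p.2)]

/-- Pullback of `dζ_j`, `dζ̄_j` under `ζ ↦ s ζ`. -/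
def covScale {n : ℕ} (s : ℂˣ) : Cov n →ₗ[ℂ] Cov n :=
  LinearMap.pi fun i => (Sum.elim (fun _ => (s : ℂ)) (fun _ => (starRingEnd ℂ) s) i)
    • LinearMap.proj i

/-- Pullback of forms under `scale s t`. -/
def pull {n : ℕ} (s t : ℂˣ) : Form n →ₐ[ℂ] Form n :=
  Algebra.TensorProduct.map (Sm.precomp s t) (ExteriorAlgebra.map (covScale s))

/-- The exterior forms of bidegree `(p, q)` with constant coefficients. -/
def bideg (n p q : ℕ) : Submodule ℂ (Lam n) :=
  (Submodule.span ℂ (Set.range eZeta)) ^ p * (Submodule.span ℂ (Set.range eZetaBar)) ^ q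

/-- The smooth projective forms on `ℙⁿ_ζ × ℙⁿ_z` of bidegree `(p, q)` in `ζ` and `(0, 0)` in `z`
with values in `𝒪_ζ(a) ⊗ 𝒪_z(b)`, in homogeneous coordinates: the smooth forms of this bidegree on
`dom n` that are annihilated by interior multiplication with both Euler fields and that are
homogeneous of degree `a` in `ζ` and `b` in `z`. -/
def projForm (n p q : ℕ) (a b : ℤ) : Submodule ℂ (Form n) where
  carrier := {u | u ∈ (bideg n p q).baseChange (Sm n) ∧ euler u = 0 ∧ eulerBar u = 0 ∧
    ∀ s t : ℂˣ, pull s t u = ((s : ℂ) ^ a * (t : ℂ) ^ b) • u}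
  add_mem' {x y} hx hy := ⟨add_mem hx.1 hy.1, by rw [map_add, hx.2.1, hy.2.1, add_zero],
    by rw [map_add, hx.2.2.1, hy.2.2.1, add_zero],
    fun s t => by rw [map_add, hx.2.2.2, hy.2.2.2, smul_add]⟩
  zero_mem' := ⟨zero_mem _, map_zero _, map_zero _, fun s t => by rw [map_zero, smul_zero]⟩
  smul_mem' c x hx := by
    refine ⟨?_, ?_, ?_, fun s t => ?_⟩
    · rw [← algebraMap_smul (Sm n) c x]
      exact Submodule.smul_mem _ _ hx.1
    · rw [LinearMap.map_smul_of_tower, hx.2.1, smul_zero]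
    · rw [LinearMap.map_smul_of_tower, hx.2.2.1, smul_zero]
    · rw [map_smul, hx.2.2.2, smul_comm]

/-- The smooth sections of `𝐋^ν(L) = ⊕_j 𝓓_{j,j+ν}(𝒪_ζ(j) ⊗ 𝒪_z(-j) ⊗ L)` for
`L = 𝒪_ζ(a) ⊗ 𝒪_z(b)`. -/
def LL (n : ℕ) (ν a b : ℤ) : Submodule ℂ (Form n) :=
  ⨆ (p : ℕ) (q : ℕ) (_ : (q : ℤ) = p + ν), projForm n p q (a + p) (b - p)

/-- The form is holomorphic in `z`: `∂/∂z̄_j` of its coefficients vanishes. -/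
def HolInZ {n : ℕ} (u : Form n) : Prop :=
  ∀ j, TensorProduct.map (dZBar j) LinearMap.id u = 0

/-- The component of bidegree `(0, 0)`, a function. -/
def comp00 {n : ℕ} : Form n →ₗ[ℂ] Sm n :=
  (TensorProduct.rid ℂ (Sm n)).toLinearMap ∘ₗ
    TensorProduct.map LinearMap.id (ExteriorAlgebra.algebraMapInv (R := ℂ) (M := Cov n)).toLinearMap

/-- The sign involution `ω ↦ (-1)^{deg ω} ω`. -/
def sgn {n : ℕ} : Form n →ₐ[ℂ] Form n :=
  Algebra.TensorProduct.map (AlgHom.id ℂ (Sm n)) CliffordAlgebra.involute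

/-! ### Complexes of sums of line bundles -/

/-- The homogeneous polynomials of degree `e`; only `0` if `e < 0`. -/
def homPoly (σ : Type) (e : ℤ) : Submodule ℂ (MvPolynomial σ ℂ) :=
  ⨆ (m : ℕ) (_ : (m : ℤ) = e), MvPolynomial.homogeneousSubmodule σ ℂ m

/-- A complex `0 → E_N → ⋯ → E_1 → E_0 → 0` over `ℙⁿ`, where `E_k` is the direct sum of the line
bundles `𝒪(-d k j)`, `j < r k`. The map `f k : E_{k+1} → E_k` is a matrix of homogeneous forms. -/
structure LineComplex (n : ℕ) where
  N : ℕ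
  r : ℕ → ℕ
  r_eq_zero : ∀ k, N < k → r k = 0
  d : ∀ k, Fin (r k) → ℤ
  f : ∀ k, Matrix (Fin (r k)) (Fin (r (k + 1))) (MvPolynomial (Fin (n + 1)) ℂ)
  homogeneous : ∀ k i j, f k i j ∈ homPoly (Fin (n + 1)) (d (k + 1) j - d k i)
  comp_eq_zero : ∀ k, f k * f (k + 1) = 0

/-- The complex `E_• ⊗ 𝒪(κ)`. -/
def LineComplex.twist {n : ℕ} (E : LineComplex n) (κ : ℤ) : LineComplex n where
  N := E.N
  r := E.r
  r_eq_zero := E.r_eq_zero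
  d k j := E.d k j - κ
  f := E.f
  homogeneous k i j := by
    rw [sub_sub_sub_cancel_right]
    exact E.homogeneous k i j
  comp_eq_zero := E.comp_eq_zero

/-- The value `p(ζ)` of a polynomial as a smooth function. -/
def atZeta {n : ℕ} : MvPolynomial (Fin (n + 1)) ℂ →ₐ[ℂ] Sm n := MvPolynomial.aeval zeta

/-- The value `p(z)` of a polynomial as a smooth function. -/
def atZed {n : ℕ} : MvPolynomial (Fin (n + 1)) ℂ →ₐ[ℂ] Sm n := MvPolynomial.aeval zed

/-- `H = (H_k^ℓ)` is a Hefer morphism for `E_•`. The entry `H k ℓ i j` is the coefficient of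
`e_{ℓ,i} ⊗ e_{k,j}^*`. The map `f_{ℓ+1}` is odd in the superbundle structure of `⊕ E_k`, so it
anticommutes with forms of odd degree: the coefficients of `f_{ℓ+1}(z) H_k^{ℓ+1}` are
`∑_ν f_{iν}(z) (-1)^{deg} (H_k^{ℓ+1})_{νj}`. -/
structure IsHefer {n : ℕ} (E : LineComplex n)
    (H : ∀ k l, Matrix (Fin (E.r l)) (Fin (E.r k)) (Form n)) : Prop where
  /-- `H_k^ℓ` is a smooth section of `𝐋^{-k+ℓ}(Hom(E_{ζ,k}, E_{z,ℓ}))`. -/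
  mem : ∀ (k l : ℕ) i j, H k l i j ∈ LL n (-(k : ℤ) + (l : ℤ)) (E.d k j) (-E.d l i)
  hol : ∀ k l i j, HolInZ (H k l i j)
  eq_zero : ∀ k l, k < l → H k l = 0
  /-- `(H_ℓ^ℓ)_{0,0}` is the identity on the diagonal; homogeneous coordinates of a point of the
  diagonal are chosen as `(ζ, ζ)`. -/
  diag : ∀ l i j (x : Fin (n + 1) → ℂ) (hx : x ≠ 0),
    (comp00 (H l l i j)).1 ⟨(x, x), hx, hx⟩ = if i = j then 1 else 0
  /-- The relation `∇_η H_k^ℓ = H_{k-1}^ℓ f_k - f_{ℓ+1}(z) H_k^{ℓ+1}` for `k ≥ 1`. -/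
  rel : ∀ k l i j, nablaEta (H (k + 1) l i j)
    = ∑ ν, atZeta (E.f k ν j) • H k l i ν - ∑ ν, atZed (E.f l i ν) • sgn (H (k + 1) (l + 1) ν j)
  /-- The same relation for `k = 0`, where `E_{-1} = 0`. -/
  rel_zero : ∀ l i j, nablaEta (H 0 l i j)
    = - ∑ ν, atZed (E.f l i ν) • sgn (H 0 (l + 1) ν j)

/-! ### Polynomial Hefer forms on `ℂⁿ⁺¹_w × ℂⁿ⁺¹_z` -/

/-- Polynomials in `w_j = inl j` and `z_j = inr j`. -/
abbrev WZ (n : ℕ) : Type := MvPolynomial (Fin (n + 1) ⊕ Fin (n + 1)) ℂ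

/-- The exterior algebra on `dw_j`. -/
abbrev LamW (n : ℕ) : Type := ExteriorAlgebra ℂ (Fin (n + 1) → ℂ)

/-- Forms in `dw_j` whose coefficients are polynomials in `(w, z)`. -/
abbrev PForm (n : ℕ) : Type := WZ n ⊗[ℂ] LamW n

/-- `δ_{z-w}`, interior multiplication by `2πi ∑ (z_j - w_j) ∂/∂w_j`. -/
def deltaZW {n : ℕ} : PForm n →ₗ[ℂ] PForm n :=
  (2 * Real.pi * Complex.I : ℂ) • ∑ j : Fin (n + 1),
    TensorProduct.map
      (LinearMap.mulLeft ℂ (MvPolynomial.X (Sum.inr j) - MvPolynomial.X (Sum.inl j) : WZ n))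
      (CliffordAlgebra.contractLeft (Q := (0 : QuadraticForm ℂ (Fin (n + 1) → ℂ)))
        (LinearMap.proj j))

/-- The `(m, 0)`-forms in `dw` whose coefficients are homogeneous polynomials in `(w, z)` of degree
`e`. -/
def homPForm (n m : ℕ) (e : ℤ) : Submodule ℂ (PForm n) :=
  LinearMap.range (TensorProduct.map (homPoly (Fin (n + 1) ⊕ Fin (n + 1)) e).subtype
    (⋀[ℂ]^m (Fin (n + 1) → ℂ)).subtype)

/-- The sign involution `ω ↦ (-1)^{deg ω} ω`. -/
def psgn {n : ℕ} : PForm n →ₐ[ℂ] PForm n :=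
  Algebra.TensorProduct.map (AlgHom.id ℂ (WZ n)) CliffordAlgebra.involute

/-- `p(w)` as a polynomial in `(w, z)`. -/
def atW {n : ℕ} : MvPolynomial (Fin (n + 1)) ℂ →ₐ[ℂ] WZ n := MvPolynomial.rename Sum.inl

/-- `p(z)` as a polynomial in `(w, z)`. -/
def atZ {n : ℕ} : MvPolynomial (Fin (n + 1)) ℂ →ₐ[ℂ] WZ n := MvPolynomial.rename Sum.inr

/-- `h = (h_k^ℓ)` are polynomial Hefer forms for `E_•`: `h_k^ℓ` is a `(k-ℓ, 0)`-form whose entries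
have homogeneous coefficients of degree `d_k^j - d_ℓ^i - (k - ℓ)`, `h_k^ℓ = 0` for `k < ℓ`,
`h_ℓ^ℓ = I` and `δ_{z-w} h_k^ℓ = h_{k-1}^ℓ F_k(w) - F_{ℓ+1}(z) h_k^{ℓ+1}`, with the same sign
convention as in `IsHefer`. For `k = 0` both sides of the last relation vanish. -/
structure IsPolyHefer {n : ℕ} (E : LineComplex n)
    (h : ∀ k l, Matrix (Fin (E.r l)) (Fin (E.r k)) (PForm n)) : Prop where
  mem : ∀ k l, l ≤ k → ∀ i j,
    h k l i j ∈ homPForm n (k - l) (E.d k j - E.d l i - ((k : ℤ) - l))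
  eq_zero : ∀ k l, k < l → h k l = 0
  eq_one : ∀ l, h l l = 1
  rel : ∀ k l i j, deltaZW (h (k + 1) l i j)
    = ∑ ν, atW (E.f k ν j) • h k l i ν - ∑ ν, atZ (E.f l i ν) • psgn (h (k + 1) (l + 1) ν j)

/-! ### The forms `α` and `γ_j`, and the substitution `τ^*` -/

/-- `∑ a_k dζ_k`. -/
def oneForm {n : ℕ} : (Fin (n + 1) → Sm n) →ₗ[ℂ] Form n where
  toFun a := ∑ k, a k ⊗ₜ[ℂ] eZeta k
  map_add' a b := by simp [TensorProduct.add_tmul, Finset.sum_add_distrib]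
  map_smul' c a := by simp [TensorProduct.smul_tmul', Finset.smul_sum]

theorem oneForm_mul_self {n : ℕ} (a : Fin (n + 1) → Sm n) : oneForm a * oneForm a = 0 := by
  have key : oneForm a * oneForm a = -(oneForm a * oneForm a) := by
    conv_lhs => simp only [oneForm, LinearMap.coe_mk, AddHom.coe_mk, Finset.sum_mul_sum]
    rw [Finset.sum_comm]
    simp only [oneForm, LinearMap.coe_mk, AddHom.coe_mk, Finset.sum_mul_sum]
    simp only [← Finset.sum_neg_distrib]
    refine Finset.sum_congr rfl fun i _ => Finset.sum_congr rfl fun j _ => ?_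
    rw [Algebra.TensorProduct.tmul_mul_tmul, Algebra.TensorProduct.tmul_mul_tmul,
      mul_comm (a j) (a i), ← TensorProduct.tmul_neg]
    congr 1
    exact eq_neg_of_add_eq_zero_left (ExteriorAlgebra.ι_add_mul_swap _ _)
  have h2 : (2 : ℂ) • (oneForm a * oneForm a) = 0 := by
    rw [two_smul]
    nth_rewrite 1 [key]
    exact neg_add_cancel _
  exact (smul_eq_zero.1 h2).resolve_left two_ne_zero

/-- `(ζ̄ · dζ) / |ζ|²`. -/
def dlog {n : ℕ} : Form n := oneForm fun k => invNsq * zetaBar k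

/-- `α = (z · ζ̄) / |ζ|² - ∂̄ ((ζ̄ · dζ) / (2πi |ζ|²))`. -/
def alpha {n : ℕ} : Form n :=
  (invNsq * ∑ j, zed j * zetaBar j) ⊗ₜ[ℂ] 1 - dbar ((1 / (2 * Real.pi * Complex.I) : ℂ) • dlog)

/-- `γ_j = dζ_j - ((ζ̄ · dζ) / |ζ|²) ζ_j`. -/
def gamma {n : ℕ} (j : Fin (n + 1)) : Form n := 1 ⊗ₜ[ℂ] eZeta j - zeta j • dlog

theorem gamma_eq {n : ℕ} (j : Fin (n + 1)) :
    (gamma j : Form n) = oneForm (Pi.single j 1 - zeta j • fun k => invNsq * zetaBar k) := by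
  rw [map_sub, gamma]
  congr 1
  · simp only [oneForm, LinearMap.coe_mk, AddHom.coe_mk]
    rw [Finset.sum_eq_single j]
    · simp
    · intro k _ hk
      simp [hk]
    · simp
  · simp [dlog, oneForm, Finset.smul_sum, TensorProduct.smul_tmul']

/-- The replacement of `dw_j` by `γ_j`, extended to all exterior products. -/
def substDw {n : ℕ} : LamW n →ₐ[ℂ] Form n :=
  ExteriorAlgebra.lift ℂ ⟨Fintype.linearCombination ℂ (gamma (n := n)), fun v => by
    have : Fintype.linearCombination ℂ (gamma (n := n)) v
        = oneForm (∑ j, v j • (Pi.single j 1 - zeta j • fun k => invNsq * zetaBar k)) := by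
      simp only [Fintype.linearCombination_apply, map_sum, map_smul, gamma_eq]
    rw [this]
    exact oneForm_mul_self _⟩

/-- The replacement of `w` by `α ζ` in a polynomial in `(w, z)`: a monomial `w^A z^B` becomes
`α^{|A|} ζ^A z^B`. (The form `α` has even degree, so it commutes with everything.) -/
def substW {n : ℕ} : WZ n →ₗ[ℂ] Form n :=
  Finsupp.lsum ℂ (fun m : (Fin (n + 1) ⊕ Fin (n + 1)) →₀ ℕ =>
    LinearMap.toSpanSingleton ℂ (Form n)
      (alpha ^ (∑ j, m (Sum.inl j)) *
        (((∏ j, zeta j ^ m (Sum.inl j)) * ∏ j, zed j ^ m (Sum.inr j)) ⊗ₜ[ℂ] 1)))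
    ∘ₗ (MvPolynomial.basisMonomials (Fin (n + 1) ⊕ Fin (n + 1)) ℂ).repr.toLinearMap

/-- `τ^*`: the replacement of `w` by `α ζ` and of `dw_j` by `γ_j`. -/
def tau {n : ℕ} : PForm n →ₗ[ℂ] Form n :=
  LinearMap.mul' ℂ (Form n) ∘ₗ TensorProduct.map substW substDw.toLinearMap

/-- `H_k^ℓ = ∑_{ij} (τ^* h_k^ℓ)_{ij} ∧ α^{κ - d_k^j} e_{ℓ,i} ⊗ e_{k,j}^*`. -/
def heferOf {n : ℕ} (E : LineComplex n) (κ : ℤ)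
    (h : ∀ k l, Matrix (Fin (E.r l)) (Fin (E.r k)) (PForm n)) (k l : ℕ) :
    Matrix (Fin (E.r l)) (Fin (E.r k)) (Form n) :=
  fun i j => tau (h k l i j) * alpha ^ (κ - E.d k j).toNat

end ProjHefer

end

/-!
# Hefer morphisms from polynomial Hefer forms

The substitution `τ^*` is a homomorphism of algebras that intertwines `δ_{z-w}` with `∇_η`, and this
is what turns polynomial Hefer forms into a Hefer morphism.

Both `δ_η` and `∂̄` are antiderivations of the algebra of forms (`IsAntiDer`), hence so is `∇_η`,
and it suffices to know it on generators. Since `∂̄∂̄ = 0` and `δ_η` anticommutes with `∂̄`, the form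
`α` is `∇_η`-closed (`nablaEta_alpha`), while `∇_η γ_j = 2πi (z_j - α ζ_j)` (`nablaEta_gamma`), which
is the image of `δ_{z-w} dw_j` under `w ↦ αζ`. As `α` is even it is central, so `τ^*` is
multiplicative, and `∇_η τ^* = τ^* δ_{z-w}` follows (`nablaEta_tau`). Applied to the relation for
`h_k^ℓ`, the coefficient `F_k(w)` becomes `F_k(αζ)`, that is, `α^(deg f)` times `f_k(ζ)`
(`substW_atW`); these powers of `α` are absorbed by the difference between the exponents `κ - d_k^j`
and `κ - d_{k-1}^i`.

The spaces `𝐋^ν` are multiplicative (`LL_mul`). The forms `α` and `γ_j` are annihilated by both Euler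
fields and are homogeneous, with `α ∈ 𝐋^0(𝒪_ζ(-1) ⊗ 𝒪_z(1))` and `γ_j ∈ 𝐋^{-1}(𝒪_z(1))`; counting
degrees gives the bundle in which each entry of `H_k^ℓ` takes its values. On the diagonal the
function part of `α` is `|ζ|²/|ζ|² = 1`, so that `H_ℓ^ℓ` restricts to the identity.

The form `∂̄∂ log |ζ|²` in `α` is handled through the explicit formula
`∑ dζ̄_j ∧ dζ_j / |ζ|² - (ζ · dζ̄) ∧ (ζ̄ · dζ) / |ζ|⁴` (`curv`), so that all identities reduce to
the values of antiderivations on functions and differentials.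
-/

noncomputable section

namespace ProjHefer

variable {n : ℕ}

/-! ### Wirtinger derivatives and scaling of the basic functions -/

theorem ext0_mk_eventuallyEq (F : Amb n → ℂ) (hF : ContDiffOn ℝ ∞ F (dom n)) {p : Amb n}
    (hp : p ∈ dom n) : ext0 (Sm.mk F hF).1 =ᶠ[nhds p] F := by
  filter_upwards [(isOpen_dom n).mem_nhds hp] with q hq
  rw [ext0_of_mem _ hq]
  rfl

theorem wirt_apply (v : Amb n) (f : Sm n) (p : dom n) :
    (wirt v f).1 p = (1 / 2 : ℂ) * (fderiv ℝ (ext0 f.1) p v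
      + Complex.I * fderiv ℝ (ext0 f.1) p (Complex.I • v)) := rfl

/-- Leibniz rule for the Wirtinger derivatives. -/
theorem wirt_mul (v : Amb n) (f g : Sm n) :
    wirt v (f * g) = wirt v f * g + f * wirt v g := Sm.ext fun p => by
  have e : fderiv ℝ (ext0 (f * g).1) p.1
      = ext0 f.1 p.1 • fderiv ℝ (ext0 g.1) p.1 + ext0 g.1 p.1 • fderiv ℝ (ext0 f.1) p.1 := by
    rw [← fderiv_mul (Sm.differentiableAt f p.2) (Sm.differentiableAt g p.2)]
    congr 1
    funext q
    by_cases hq : q ∈ dom n <;> simp [ext0, hq]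
  change _ = (wirt v f).1 p * g.1 p + f.1 p * (wirt v g).1 p
  rw [wirt_apply, wirt_apply, wirt_apply, e, ext0_of_mem _ p.2, ext0_of_mem _ p.2]
  simp only [add_apply, smul_apply, smul_eq_mul]
  ring

/-- The Wirtinger derivative of a function that is real-linear in `(ζ, z)` is constant. -/
theorem wirt_mk_clm (v : Amb n) (A : Amb n →L[ℝ] ℂ) (hA : ContDiffOn ℝ ∞ (fun p => A p) (dom n)) :
    wirt v (Sm.mk (fun p => A p) hA)
      = algebraMap ℂ (Sm n) ((1 / 2 : ℂ) * (A v + Complex.I * A (Complex.I • v))) :=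
  Sm.ext fun p => by
    rw [wirt_apply, (ext0_mk_eventuallyEq _ hA p.2).fderiv_eq, A.fderiv]
    rfl

theorem wirt_zeta (v : Amb n) (j : Fin (n + 1)) : wirt v (zeta j) = 0 := by
  refine (wirt_mk_clm v ((ContinuousLinearMap.proj (R := ℝ) (φ := fun _ => ℂ) j).comp
    (ContinuousLinearMap.fst ℝ (Fin (n + 1) → ℂ) (Fin (n + 1) → ℂ))) (by fun_prop)).trans ?_
  have : (1 / 2 : ℂ) * (v.1 j + Complex.I * (Complex.I * v.1 j)) = 0 := by
    linear_combination (1 / 2 : ℂ) * v.1 j * Complex.I_mul_I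
  exact (congrArg _ this).trans (map_zero _)

theorem wirt_zed (v : Amb n) (j : Fin (n + 1)) : wirt v (zed j) = 0 := by
  refine (wirt_mk_clm v ((ContinuousLinearMap.proj (R := ℝ) (φ := fun _ => ℂ) j).comp
    (ContinuousLinearMap.snd ℝ (Fin (n + 1) → ℂ) (Fin (n + 1) → ℂ))) (by fun_prop)).trans ?_
  have : (1 / 2 : ℂ) * (v.2 j + Complex.I * (Complex.I * v.2 j)) = 0 := by
    linear_combination (1 / 2 : ℂ) * v.2 j * Complex.I_mul_I
  exact (congrArg _ this).trans (map_zero _)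

theorem wirt_zetaBar (v : Amb n) (j : Fin (n + 1)) :
    wirt v (zetaBar j) = algebraMap ℂ (Sm n) (starRingEnd ℂ (v.1 j)) := by
  refine (wirt_mk_clm v ((Complex.conjCLE : ℂ →L[ℝ] ℂ).comp
    ((ContinuousLinearMap.proj (R := ℝ) (φ := fun _ => ℂ) j).comp
    (ContinuousLinearMap.fst ℝ (Fin (n + 1) → ℂ) (Fin (n + 1) → ℂ)))) (by fun_prop)).trans ?_
  have : (1 / 2 : ℂ) * (starRingEnd ℂ (v.1 j)
      + Complex.I * starRingEnd ℂ (Complex.I * v.1 j)) = starRingEnd ℂ (v.1 j) := by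
    rw [map_mul, Complex.conj_I]
    linear_combination -(1 / 2 : ℂ) * starRingEnd ℂ (v.1 j) * Complex.I_mul_I
  exact congrArg _ this

theorem wirt_one (v : Amb n) : wirt v 1 = 0 := by
  have h := wirt_mul v 1 1
  rwa [mul_one, mul_one, one_mul, left_eq_add] at h

/-- `|ζ|² = ∑ ζ_j ζ̄_j` is inverse to `invNsq`. -/
theorem sum_zeta_mul_zetaBar_mul_invNsq :
    (∑ j, zeta j * zetaBar j) * invNsq = (1 : Sm n) := Sm.ext fun p => by
  change ((∑ j, zeta j * zetaBar j : Sm n) : dom n → ℂ) p * (nsq p.1)⁻¹ = 1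
  have : ((∑ j, zeta j * zetaBar j : Sm n) : dom n → ℂ) p = nsq p.1 := by
    rw [AddSubmonoidClass.coe_finsetSum, Finset.sum_apply]
    rfl
  rw [this, mul_inv_cancel₀ (nsq_ne_zero p.2)]

/-- The derivative of `1 / |ζ|²`, read off from `|ζ|² · (1 / |ζ|²) = 1`. -/
theorem wirt_invNsq (v : Amb n) :
    wirt v invNsq = -(invNsq * invNsq *
      ∑ j, algebraMap ℂ (Sm n) (starRingEnd ℂ (v.1 j)) * zeta j) := by
  have h := congrArg (wirt v) (sum_zeta_mul_zetaBar_mul_invNsq (n := n))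
  rw [wirt_mul, wirt_one, map_sum] at h
  simp only [wirt_mul, wirt_zeta, wirt_zetaBar, zero_mul, zero_add] at h
  simp only [mul_comm (zeta _) (algebraMap ℂ (Sm n) _)] at h
  linear_combination invNsq * h - wirt v invNsq * (sum_zeta_mul_zetaBar_mul_invNsq (n := n))

theorem precomp_zeta (s t : ℂˣ) (j : Fin (n + 1)) :
    Sm.precomp s t (zeta j) = (s : ℂ) • zeta j := Sm.ext fun p => by
  change ext0 (zeta j).1 (scale s t p.1) = _
  rw [ext0_of_mem _ (scale_mem s t p.2)]
  rfl

theorem precomp_zed (s t : ℂˣ) (j : Fin (n + 1)) :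
    Sm.precomp s t (zed j) = (t : ℂ) • zed j := Sm.ext fun p => by
  change ext0 (zed j).1 (scale s t p.1) = _
  rw [ext0_of_mem _ (scale_mem s t p.2)]
  rfl

theorem precomp_zetaBar (s t : ℂˣ) (j : Fin (n + 1)) :
    Sm.precomp s t (zetaBar j) = (starRingEnd ℂ s) • zetaBar j := Sm.ext fun p => by
  change ext0 (zetaBar j).1 (scale s t p.1) = _
  rw [ext0_of_mem _ (scale_mem s t p.2)]
  exact map_mul (starRingEnd ℂ) _ _

theorem precomp_invNsq (s t : ℂˣ) :
    Sm.precomp s t (invNsq (n := n)) = ((s : ℂ) * starRingEnd ℂ s)⁻¹ • invNsq := Sm.ext fun p => by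
  change ext0 invNsq.1 (scale s t p.1) = ((s : ℂ) * starRingEnd ℂ s)⁻¹ * (nsq p.1)⁻¹
  rw [ext0_of_mem _ (scale_mem s t p.2), ← mul_inv]
  change (nsq (scale s t p.1))⁻¹ = _
  congr 1
  simp only [nsq, scale, Pi.smul_apply, smul_eq_mul, map_mul, Finset.mul_sum]
  exact Finset.sum_congr rfl fun j _ => by ring

/-! ### Functions and differentials as forms, and the sign involution -/

/-- A smooth function, regarded as a form of degree `0`. -/
def fn : Sm n →ₐ[ℂ] Form n := Algebra.TensorProduct.includeLeft

/-- The form `dζ_j`. -/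
def dz (j : Fin (n + 1)) : Form n := 1 ⊗ₜ eZeta j

/-- The form `dζ̄_j`. -/
def dzb (j : Fin (n + 1)) : Form n := 1 ⊗ₜ eZetaBar j

theorem smul_eq_fn_mul (f : Sm n) (u : Form n) : f • u = fn f * u := Algebra.smul_def f u

theorem fn_comm (f : Sm n) (u : Form n) : fn f * u = u * fn f := Algebra.commutes f u

theorem smul_tmul_one (f : Sm n) (x : Lam n) : f • (1 : Sm n) ⊗ₜ[ℂ] x = f ⊗ₜ[ℂ] x := by
  rw [TensorProduct.smul_tmul', smul_eq_mul, mul_one]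

theorem sgn_tmul (f : Sm n) (x : Lam n) : sgn (f ⊗ₜ[ℂ] x) = f ⊗ₜ CliffordAlgebra.involute x := rfl

theorem sgn_fn (f : Sm n) : sgn (fn f) = fn f := by
  change sgn (f ⊗ₜ 1) = f ⊗ₜ 1
  rw [sgn_tmul, map_one]

theorem sgn_dz (j : Fin (n + 1)) : sgn (dz j : Form n) = -dz j := by
  rw [dz, sgn_tmul, eZeta, CliffordAlgebra.involute_ι, TensorProduct.tmul_neg]

theorem sgn_dzb (j : Fin (n + 1)) : sgn (dzb j : Form n) = -dzb j := by
  rw [dzb, sgn_tmul, eZetaBar, CliffordAlgebra.involute_ι, TensorProduct.tmul_neg]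

theorem sgn_smul (f : Sm n) (u : Form n) : sgn (f • u) = f • sgn u := by
  rw [smul_eq_fn_mul, map_mul, sgn_fn, smul_eq_fn_mul]

/-- Moving a one-form past a form costs the sign involution. -/
theorem ι_mul_eq (v : Cov n) (x : Lam n) :
    ExteriorAlgebra.ι ℂ v * x = CliffordAlgebra.involute x * ExteriorAlgebra.ι ℂ v := by
  induction x using CliffordAlgebra.left_induction with
  | algebraMap r =>
    rw [AlgHom.commutes]
    exact (Algebra.commutes r _).symm
  | add x y hx hy => rw [mul_add, hx, hy, map_add, add_mul]
  | ι_mul x m hx =>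
    rw [map_mul, CliffordAlgebra.involute_ι, neg_mul, neg_mul, mul_assoc, ← hx, ← mul_assoc,
      ← mul_assoc, ← neg_mul]
    congr 1
    exact eq_neg_of_add_eq_zero_left (ExteriorAlgebra.ι_add_mul_swap _ _)

theorem tmul_ι_mul (f : Sm n) (v : Cov n) (u : Form n) :
    f ⊗ₜ ExteriorAlgebra.ι ℂ v * u = sgn u * f ⊗ₜ ExteriorAlgebra.ι ℂ v := by
  induction u using TensorProduct.induction_on with
  | zero => rw [mul_zero, map_zero, zero_mul]
  | add x y hx hy => rw [mul_add, hx, hy, map_add, add_mul]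
  | tmul g x =>
    rw [sgn_tmul, Algebra.TensorProduct.tmul_mul_tmul, Algebra.TensorProduct.tmul_mul_tmul,
      ι_mul_eq, mul_comm]

theorem dz_mul (j : Fin (n + 1)) (u : Form n) : dz j * u = sgn u * dz j := tmul_ι_mul _ _ _

theorem dzb_mul (j : Fin (n + 1)) (u : Form n) : dzb j * u = sgn u * dzb j := tmul_ι_mul _ _ _

theorem sgn_sgn (u : Form n) : sgn (sgn u) = u := by
  induction u using TensorProduct.induction_on with
  | zero => rw [map_zero, map_zero]
  | add x y hx hy => rw [map_add, map_add, hx, hy]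
  | tmul g x => rw [sgn_tmul, sgn_tmul, CliffordAlgebra.involute_involute]

/-! ### Antiderivations -/

/-- `D` is an antiderivation of the algebra of forms: `D(uv) = (Du)v + (-1)^{deg u} u(Dv)`. -/
def IsAntiDer (D : Form n →ₗ[ℂ] Form n) : Prop :=
  ∀ u v, D (u * v) = D u * v + sgn u * D v

namespace IsAntiDer

variable {D D' : Form n →ₗ[ℂ] Form n}

theorem of_tmul (h : ∀ (f g : Sm n) (x y : Lam n), D ((f * g) ⊗ₜ[ℂ] (x * y))
    = D (f ⊗ₜ x) * g ⊗ₜ y + f ⊗ₜ CliffordAlgebra.involute x * D (g ⊗ₜ y)) : IsAntiDer D := by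
  intro u v
  induction u using TensorProduct.induction_on with
  | zero => simp only [zero_mul, map_zero, add_zero]
  | add x y hx hy =>
    rw [add_mul, map_add, map_add, map_add, hx, hy, add_mul, add_mul]
    abel
  | tmul f x =>
    induction v using TensorProduct.induction_on with
    | zero => simp only [mul_zero, map_zero, add_zero]
    | add y z hy hz =>
      rw [mul_add, map_add, map_add, hy, hz, mul_add, mul_add]
      abel
    | tmul g y => rw [Algebra.TensorProduct.tmul_mul_tmul, h, sgn_tmul]

theorem zero : IsAntiDer (0 : Form n →ₗ[ℂ] Form n) := fun u v => by
  simp only [LinearMap.zero_apply, zero_mul, mul_zero, add_zero]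

theorem add (h : IsAntiDer D) (h' : IsAntiDer D') : IsAntiDer (D + D') := fun u v => by
  simp only [LinearMap.add_apply, h u v, h' u v, add_mul, mul_add]
  abel

theorem sub (h : IsAntiDer D) (h' : IsAntiDer D') : IsAntiDer (D - D') := fun u v => by
  simp only [LinearMap.sub_apply, h u v, h' u v, sub_mul, mul_sub]
  abel

theorem sum {ι : Type} (s : Finset ι) (F : ι → Form n →ₗ[ℂ] Form n)
    (h : ∀ i ∈ s, IsAntiDer (F i)) : IsAntiDer (∑ i ∈ s, F i) :=
  Finset.sum_induction F IsAntiDer (fun _ _ => add) zero h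

theorem const_smul (c : ℂ) (h : IsAntiDer D) : IsAntiDer (c • D) := fun u v => by
  simp only [LinearMap.smul_apply, h u v, smul_add, smul_mul_assoc, mul_smul_comm]

theorem one (h : IsAntiDer D) : D 1 = 0 := by
  have h := h 1 1
  rwa [mul_one, mul_one, map_one sgn, one_mul, left_eq_add] at h

theorem smul (h : IsAntiDer D) (f : Sm n) (u : Form n) :
    D (f • u) = D (fn f) * u + f • D u := by
  rw [smul_eq_fn_mul, h, sgn_fn, ← smul_eq_fn_mul f (D u)]

theorem pow_eq_zero (h : IsAntiDer D) {u : Form n} (hu : D u = 0) (m : ℕ) : D (u ^ m) = 0 := by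
  induction m with
  | zero => rw [pow_zero, h.one]
  | succ m ih => rw [pow_succ, h, ih, hu, zero_mul, mul_zero, add_zero]

end IsAntiDer

theorem contractLeft_mul (d : Module.Dual ℂ (Cov n)) (x y : Lam n) :
    CliffordAlgebra.contractLeft d (x * y) = CliffordAlgebra.contractLeft d x * y
      + CliffordAlgebra.involute x * CliffordAlgebra.contractLeft d y := by
  induction x using CliffordAlgebra.left_induction with
  | algebraMap r =>
    rw [CliffordAlgebra.contractLeft_algebraMap_mul, CliffordAlgebra.contractLeft_algebraMap,
      AlgHom.commutes, zero_mul, zero_add]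
  | add x z hx hz =>
    rw [add_mul, map_add, map_add, map_add, hx, hz, add_mul, add_mul]
    abel
  | ι_mul x m hx =>
    rw [mul_assoc, CliffordAlgebra.contractLeft_ι_mul, CliffordAlgebra.contractLeft_ι_mul, hx,
      map_mul, CliffordAlgebra.involute_ι, sub_mul, smul_mul_assoc, mul_add, neg_mul, neg_mul,
      mul_assoc, mul_assoc]
    abel

theorem contr_tmul (i : Fin (n + 1) ⊕ Fin (n + 1)) (f : Sm n) (x : Lam n) :
    contr i (f ⊗ₜ[ℂ] x) = f ⊗ₜ CliffordAlgebra.contractLeft (Q := (0 : QuadraticForm ℂ (Cov n)))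
      (LinearMap.proj i) x := rfl

theorem isAntiDer_smul_contr (f : Sm n) (i : Fin (n + 1) ⊕ Fin (n + 1)) :
    IsAntiDer ((f • (contr i : Form n →ₗ[Sm n] Form n)).restrictScalars ℂ) :=
  IsAntiDer.of_tmul fun g h x y => by
    simp only [LinearMap.restrictScalars_apply, LinearMap.smul_apply, contr_tmul,
      contractLeft_mul, TensorProduct.tmul_add, smul_add, smul_mul_assoc, mul_smul_comm,
      Algebra.TensorProduct.tmul_mul_tmul]

theorem isAntiDer_dbar : IsAntiDer (dbar : Form n →ₗ[ℂ] Form n) :=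
  IsAntiDer.sum _ _ fun j _ => IsAntiDer.of_tmul fun f g x y => by
    simp only [TensorProduct.map_tmul, LinearMap.mulLeft_apply,
      Algebra.TensorProduct.tmul_mul_tmul]
    rw [dZetaBar, wirt_mul, TensorProduct.add_tmul, mul_assoc, ← mul_assoc _ (eZetaBar j),
      show CliffordAlgebra.involute x * eZetaBar j = eZetaBar j * x from (ι_mul_eq _ _).symm,
      mul_assoc]

theorem isAntiDer_deltaEta : IsAntiDer (deltaEta : Form n →ₗ[ℂ] Form n) :=
  (IsAntiDer.sum _ _ fun j _ => isAntiDer_smul_contr (zed j) (Sum.inl j)).const_smul _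

theorem isAntiDer_nablaEta : IsAntiDer (nablaEta : Form n →ₗ[ℂ] Form n) :=
  isAntiDer_deltaEta.sub isAntiDer_dbar

theorem isAntiDer_euler : IsAntiDer ((euler : Form n →ₗ[Sm n] Form n).restrictScalars ℂ) := by
  have h := IsAntiDer.sum (n := n) Finset.univ _
    fun j _ => isAntiDer_smul_contr (zeta j) (Sum.inl j)
  intro u v
  simpa [euler] using h u v

theorem isAntiDer_eulerBar :
    IsAntiDer ((eulerBar : Form n →ₗ[Sm n] Form n).restrictScalars ℂ) := by
  have h := IsAntiDer.sum (n := n) Finset.univ _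
    fun j _ => isAntiDer_smul_contr (zetaBar j) (Sum.inr j)
  intro u v
  simpa [eulerBar] using h u v

/-! ### Values of the antiderivations on functions and differentials -/

theorem contr_fn (i : Fin (n + 1) ⊕ Fin (n + 1)) (f : Sm n) : contr i (fn f) = 0 := by
  change contr i (f ⊗ₜ 1) = 0
  rw [contr_tmul, CliffordAlgebra.contractLeft_one, TensorProduct.tmul_zero]

theorem contr_dz (i : Fin (n + 1) ⊕ Fin (n + 1)) (j : Fin (n + 1)) :
    contr i (dz j : Form n) = if i = Sum.inl j then 1 else 0 := by
  rw [dz, contr_tmul, eZeta, CliffordAlgebra.contractLeft_ι, LinearMap.proj_apply,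
    Pi.single_apply]
  split_ifs
  · rw [map_one]; rfl
  · rw [map_zero, TensorProduct.tmul_zero]

theorem contr_dzb (i : Fin (n + 1) ⊕ Fin (n + 1)) (j : Fin (n + 1)) :
    contr i (dzb j : Form n) = if i = Sum.inr j then 1 else 0 := by
  rw [dzb, contr_tmul, eZetaBar, CliffordAlgebra.contractLeft_ι, LinearMap.proj_apply,
    Pi.single_apply]
  split_ifs
  · rw [map_one]; rfl
  · rw [map_zero, TensorProduct.tmul_zero]

theorem deltaEta_apply (u : Form n) : deltaEta u
    = (2 * Real.pi * Complex.I : ℂ) • ∑ j, (zed j : Sm n) • contr (Sum.inl j) u := by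
  simp [deltaEta]

theorem euler_apply (u : Form n) : euler u = ∑ j, (zeta j : Sm n) • contr (Sum.inl j) u := by
  simp [euler]

theorem eulerBar_apply (u : Form n) :
    eulerBar u = ∑ j, (zetaBar j : Sm n) • contr (Sum.inr j) u := by
  simp [eulerBar]

theorem deltaEta_fn (f : Sm n) : deltaEta (fn f) = 0 := by
  simp only [deltaEta_apply, contr_fn, smul_zero, Finset.sum_const_zero]

theorem euler_fn (f : Sm n) : euler (fn f) = 0 := by
  simp only [euler_apply, contr_fn, smul_zero, Finset.sum_const_zero]

theorem eulerBar_fn (f : Sm n) : eulerBar (fn f) = 0 := by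
  simp only [eulerBar_apply, contr_fn, smul_zero, Finset.sum_const_zero]

theorem smul_one_eq_fn (f : Sm n) : f • (1 : Form n) = fn f := by
  rw [smul_eq_fn_mul, mul_one]

theorem deltaEta_dz (j : Fin (n + 1)) :
    deltaEta (dz j : Form n) = (2 * Real.pi * Complex.I : ℂ) • fn (zed j) := by
  simp [deltaEta_apply, contr_dz, smul_one_eq_fn]

theorem deltaEta_dzb (j : Fin (n + 1)) : deltaEta (dzb j : Form n) = 0 := by
  simp [deltaEta_apply, contr_dzb]

theorem euler_dz (j : Fin (n + 1)) : euler (dz j : Form n) = fn (zeta j) := by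
  simp [euler_apply, contr_dz, smul_one_eq_fn]

theorem euler_dzb (j : Fin (n + 1)) : euler (dzb j : Form n) = 0 := by
  simp [euler_apply, contr_dzb]

theorem eulerBar_dz (j : Fin (n + 1)) : eulerBar (dz j : Form n) = 0 := by
  simp [eulerBar_apply, contr_dz]

theorem eulerBar_dzb (j : Fin (n + 1)) : eulerBar (dzb j : Form n) = fn (zetaBar j) := by
  simp [eulerBar_apply, contr_dzb, smul_one_eq_fn]

theorem dbar_tmul (f : Sm n) (x : Lam n) :
    dbar (f ⊗ₜ[ℂ] x) = ∑ j, dZetaBar j f ⊗ₜ (eZetaBar j * x) := by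
  simp [dbar]

theorem dbar_fn (f : Sm n) : dbar (fn f) = ∑ j, dZetaBar j f • (dzb j : Form n) := by
  change dbar (f ⊗ₜ 1) = _
  simp only [dbar_tmul, mul_one, dzb, smul_tmul_one]

theorem dbar_one_tmul (x : Lam n) : dbar ((1 : Sm n) ⊗ₜ[ℂ] x) = 0 := by
  simp only [dbar_tmul, dZetaBar, wirt_one, TensorProduct.zero_tmul, Finset.sum_const_zero]

theorem dbar_dz (j : Fin (n + 1)) : dbar (dz j : Form n) = 0 := dbar_one_tmul _

theorem dbar_dzb (j : Fin (n + 1)) : dbar (dzb j : Form n) = 0 := dbar_one_tmul _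

theorem dZetaBar_zetaBar (i j : Fin (n + 1)) :
    dZetaBar i (zetaBar j) = if i = j then (1 : Sm n) else 0 := by
  rw [dZetaBar, wirt_zetaBar]
  by_cases h : i = j
  · subst h; simp
  · simp [h, Ne.symm h]

theorem dZetaBar_invNsq (i : Fin (n + 1)) :
    dZetaBar i (invNsq (n := n)) = -(invNsq * invNsq * zeta i) := by
  rw [dZetaBar, wirt_invNsq]
  congr 2
  rw [Finset.sum_eq_single i]
  · simp
  · intro j _ hj
    simp [hj]
  · simp

theorem dbar_fn_zeta (j : Fin (n + 1)) : dbar (fn (zeta j) : Form n) = 0 := by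
  simp only [dbar_fn, dZetaBar, wirt_zeta, zero_smul, Finset.sum_const_zero]

theorem dbar_fn_zed (j : Fin (n + 1)) : dbar (fn (zed j) : Form n) = 0 := by
  simp only [dbar_fn, dZetaBar, wirt_zed, zero_smul, Finset.sum_const_zero]

theorem dbar_fn_zetaBar (j : Fin (n + 1)) : dbar (fn (zetaBar j) : Form n) = dzb j := by
  simp [dbar_fn, dZetaBar_zetaBar]

theorem dbar_fn_invNsq :
    dbar (fn invNsq : Form n) = -((invNsq * invNsq : Sm n) • ∑ j, zeta j • (dzb j : Form n)) := by
  simp only [dbar_fn, dZetaBar_invNsq, Finset.smul_sum, neg_smul, Finset.sum_neg_distrib,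
    mul_smul]

/-! ### The forms `α` and `γ_j` -/

/-- The form `ζ̄ · dζ`. -/
def phi : Form n := ∑ j, (zetaBar j : Sm n) • (dz j : Form n)

/-- The form `ζ · dζ̄`. -/
def theta : Form n := ∑ j, (zeta j : Sm n) • (dzb j : Form n)

/-- The form `z · dζ̄`. -/
def psi : Form n := ∑ j, (zed j : Sm n) • (dzb j : Form n)

/-- The form `∑ dζ̄_j ∧ dζ_j`. -/
def omega : Form n := ∑ j, dzb j * (dz j : Form n)

/-- The function `z · ζ̄`. -/
def pairing : Sm n := ∑ j, zed j * zetaBar j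

theorem dlog_eq : (dlog : Form n) = (invNsq : Sm n) • phi := by
  change ∑ k, (invNsq * zetaBar k) ⊗ₜ[ℂ] eZeta k = _
  simp only [phi, dz, Finset.smul_sum, TensorProduct.smul_tmul', smul_eq_mul,
    mul_one]

theorem gamma_eq_sub (j : Fin (n + 1)) :
    (gamma j : Form n) = dz j - (zeta j : Sm n) • (dlog : Form n) := rfl

theorem dbar_smul (f : Sm n) (u : Form n) : dbar (f • u) = dbar (fn f) * u + f • dbar u :=
  isAntiDer_dbar.smul f u

theorem deltaEta_smul (f : Sm n) (u : Form n) : deltaEta (f • u) = f • deltaEta u := by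
  rw [isAntiDer_deltaEta.smul, deltaEta_fn, zero_mul, zero_add]

theorem euler_smul (f : Sm n) (u : Form n) : euler (f • u) = f • euler u := map_smul _ _ _

theorem eulerBar_smul (f : Sm n) (u : Form n) : eulerBar (f • u) = f • eulerBar u :=
  map_smul _ _ _

theorem fn_mul (f g : Sm n) : fn (f * g) = fn f * fn g := map_mul _ _ _

theorem dbar_mul (u v : Form n) : dbar (u * v) = dbar u * v + sgn u * dbar v :=
  isAntiDer_dbar u v

theorem deltaEta_mul (u v : Form n) : deltaEta (u * v) = deltaEta u * v + sgn u * deltaEta v :=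
  isAntiDer_deltaEta u v

theorem euler_mul (u v : Form n) : euler (u * v) = euler u * v + sgn u * euler v :=
  isAntiDer_euler u v

theorem eulerBar_mul (u v : Form n) : eulerBar (u * v) = eulerBar u * v + sgn u * eulerBar v :=
  isAntiDer_eulerBar u v

theorem sgn_phi : sgn (phi : Form n) = -phi := by
  simp only [phi, map_sum, sgn_smul, sgn_dz, smul_neg, Finset.sum_neg_distrib]

theorem sgn_theta : sgn (theta : Form n) = -theta := by
  simp only [theta, map_sum, sgn_smul, sgn_dzb, smul_neg, Finset.sum_neg_distrib]

theorem sgn_omega : sgn (omega : Form n) = omega := by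
  simp only [omega, map_sum, map_mul, sgn_dz, sgn_dzb, neg_mul_neg]

theorem theta_mul (u : Form n) : theta * u = sgn u * theta := by
  simp only [theta, Finset.sum_mul, Finset.mul_sum, smul_mul_assoc, mul_smul_comm, dzb_mul]

theorem phi_mul (u : Form n) : phi * u = sgn u * phi := by
  simp only [phi, Finset.sum_mul, Finset.mul_sum, smul_mul_assoc, mul_smul_comm, dz_mul]

theorem theta_mul_self : (theta * theta : Form n) = 0 := by
  have h := theta_mul (theta : Form n)
  rw [sgn_theta, neg_mul, eq_neg_iff_add_eq_zero, ← two_smul ℂ] at h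
  exact (smul_eq_zero.1 h).resolve_left two_ne_zero

theorem theta_mul_phi_mul (u : Form n) :
    (theta : Form n) * phi * u = u * ((theta : Form n) * phi) := by
  rw [mul_assoc, phi_mul, ← mul_assoc, theta_mul, sgn_sgn, mul_assoc]

theorem omega_mul (u : Form n) : omega * u = u * omega := by
  simp only [omega, Finset.sum_mul, Finset.mul_sum]
  refine Finset.sum_congr rfl fun j _ => ?_
  rw [mul_assoc, dz_mul, ← mul_assoc, dzb_mul, sgn_sgn, mul_assoc]

theorem dbar_phi : dbar (phi : Form n) = omega := by
  simp only [phi, map_sum, dbar_smul, dbar_fn_zetaBar, dbar_dz, smul_zero, add_zero, omega]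

theorem dbar_theta : dbar (theta : Form n) = 0 := by
  simp only [theta, map_sum, dbar_smul, dbar_fn_zeta, dbar_dzb, smul_zero, add_zero, zero_mul,
    Finset.sum_const_zero]

theorem dbar_omega : dbar (omega : Form n) = 0 := by
  simp only [omega, map_sum, dbar_mul, dbar_dz, dbar_dzb, zero_mul, mul_zero, add_zero,
    Finset.sum_const_zero]

theorem dbar_fn_invNsq_eq : dbar (fn invNsq : Form n) = -((invNsq * invNsq : Sm n) • theta) :=
  dbar_fn_invNsq

/-- The form `∂̄∂ log |ζ|²`, written out; `dbar_dlog` identifies it with `∂̄` of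
`ζ̄ · dζ / |ζ|²`. -/
def curv : Form n := (invNsq : Sm n) • omega - (invNsq * invNsq : Sm n) • ((theta : Form n) * phi)

theorem dbar_dlog : dbar (dlog : Form n) = curv := by
  rw [dlog_eq, dbar_smul, dbar_phi, dbar_fn_invNsq_eq, neg_mul, smul_mul_assoc, curv]
  abel

theorem curv_mul (u : Form n) : curv * u = u * curv := by
  simp only [curv, sub_mul, mul_sub, smul_mul_assoc, mul_smul_comm, omega_mul, theta_mul_phi_mul]

theorem sgn_curv : sgn (curv : Form n) = curv := by
  simp only [curv, map_sub, sgn_smul, sgn_omega, map_mul, sgn_theta, sgn_phi, neg_mul_neg]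

theorem dbar_curv : dbar (curv : Form n) = 0 := by
  rw [curv, map_sub, dbar_smul, dbar_smul, fn_mul, dbar_mul (fn (invNsq : Sm n)),
    dbar_mul (theta : Form n), dbar_fn_invNsq_eq, dbar_omega, dbar_phi, dbar_theta,
    sgn_theta, sgn_fn]
  simp only [neg_mul, mul_neg, smul_mul_assoc, smul_zero, zero_mul, zero_add, add_zero, smul_neg,
    add_mul, ← fn_comm, ← smul_eq_fn_mul, mul_smul_comm]
  -- the term with `∂̄ |ζ|⁻⁴` vanishes as `θ ∧ θ = 0`; the terms in `θ ∧ ω` cancel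
  simp only [← mul_assoc (theta : Form n), theta_mul_self, zero_mul, smul_zero]
  abel

theorem dbar_fn_pairing : dbar (fn pairing : Form n) = psi := by
  simp only [pairing, map_sum, fn_mul, dbar_mul, dbar_fn_zed, dbar_fn_zetaBar, sgn_fn,
    zero_mul, zero_add, psi, smul_eq_fn_mul]

theorem deltaEta_phi : deltaEta (phi : Form n) = (2 * Real.pi * Complex.I : ℂ) • fn pairing := by
  simp only [phi, pairing, map_sum, deltaEta_smul, deltaEta_dz, Finset.smul_sum]
  refine Finset.sum_congr rfl fun j _ => ?_
  rw [smul_comm, smul_eq_fn_mul, mul_comm (zed j), fn_mul]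

theorem deltaEta_theta : deltaEta (theta : Form n) = 0 := by
  simp only [theta, map_sum, deltaEta_smul, deltaEta_dzb, smul_zero, Finset.sum_const_zero]

theorem deltaEta_omega : deltaEta (omega : Form n) = -((2 * Real.pi * Complex.I : ℂ) • psi) := by
  simp only [omega, psi, map_sum, deltaEta_mul, deltaEta_dzb, deltaEta_dz, zero_mul, zero_add,
    sgn_dzb, neg_mul, mul_smul_comm, ← fn_comm, smul_eq_fn_mul, ← Finset.sum_neg_distrib,
    Finset.smul_sum, smul_neg]

/-- The identity `δ_η ∂̄ = -∂̄ δ_η` for the form `ζ̄ · dζ / |ζ|²`. -/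
theorem deltaEta_curv : deltaEta (curv : Form n)
    = -((2 * Real.pi * Complex.I : ℂ) • dbar (fn (invNsq * pairing))) := by
  rw [fn_mul, dbar_mul, dbar_fn_invNsq_eq, dbar_fn_pairing, sgn_fn, curv, map_sub,
    deltaEta_smul, deltaEta_smul, deltaEta_omega, deltaEta_mul, deltaEta_theta, deltaEta_phi,
    sgn_theta, zero_mul, zero_add, ← smul_eq_fn_mul, neg_mul, neg_mul, mul_smul_comm, smul_neg,
    smul_neg, smul_mul_assoc, smul_add, smul_neg, smul_comm (invNsq : Sm n),
    smul_comm (invNsq * invNsq : Sm n)]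
  abel

theorem alpha_eq : (alpha : Form n)
    = fn (invNsq * pairing) - (1 / (2 * Real.pi * Complex.I) : ℂ) • curv := by
  rw [← dbar_dlog, ← map_smul]
  rfl

theorem two_pi_I_smul_inv_smul (u : Form n) :
    (2 * Real.pi * Complex.I : ℂ) • (1 / (2 * Real.pi * Complex.I) : ℂ) • u = u := by
  rw [smul_smul, mul_one_div_cancel Complex.two_pi_I_ne_zero, one_smul]

/-- The form `α` is `∇_η`-closed. -/
theorem nablaEta_alpha : nablaEta (alpha : Form n) = 0 := by
  rw [nablaEta, LinearMap.sub_apply, alpha_eq, map_sub, map_sub, map_smul, map_smul, dbar_curv,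
    deltaEta_fn, deltaEta_curv, smul_neg, smul_comm (1 / _ : ℂ), two_pi_I_smul_inv_smul, smul_zero]
  abel

theorem alpha_mul (u : Form n) : alpha * u = u * alpha := by
  rw [alpha_eq, sub_mul, mul_sub, fn_comm, smul_mul_assoc, mul_smul_comm, curv_mul]

theorem sgn_alpha : sgn (alpha : Form n) = alpha := by
  rw [alpha_eq, map_sub, sgn_fn, map_smul, sgn_curv]

theorem sgn_gamma (j : Fin (n + 1)) : sgn (gamma j : Form n) = -gamma j := by
  rw [gamma_eq_sub, dlog_eq, map_sub, sgn_dz, sgn_smul, sgn_smul, sgn_phi, smul_neg, smul_neg]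
  abel

/-- `∇_η γ_j = 2πi (z_j - α ζ_j)`, the substitution of `w = α ζ` in `δ_{z-w} dw_j`. -/
theorem nablaEta_gamma (j : Fin (n + 1)) : nablaEta (gamma j : Form n)
    = (2 * Real.pi * Complex.I : ℂ) • (fn (zed j) - alpha * fn (zeta j)) := by
  have h : dbar (gamma j : Form n) = -((zeta j : Sm n) • curv) := by
    rw [gamma_eq_sub, map_sub, dbar_dz, dbar_smul, dbar_fn_zeta, dbar_dlog, zero_mul, zero_add,
      zero_sub]
  rw [nablaEta, LinearMap.sub_apply, h, gamma_eq_sub, dlog_eq, map_sub, deltaEta_dz,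
    deltaEta_smul, deltaEta_smul, deltaEta_phi, ← fn_comm, alpha_eq, mul_sub, smul_sub, smul_sub,
    mul_smul_comm, two_pi_I_smul_inv_smul, ← smul_eq_fn_mul, ← smul_eq_fn_mul, fn_mul,
    ← smul_eq_fn_mul invNsq, smul_comm (2 * Real.pi * Complex.I : ℂ) (zeta j : Sm n),
    smul_comm (2 * Real.pi * Complex.I : ℂ) (invNsq : Sm n)]
  abel

theorem fn_sum_zeta_mul_zetaBar_mul_invNsq :
    fn (∑ j, zeta j * zetaBar j) * fn invNsq = (1 : Form n) := by
  rw [← map_mul, sum_zeta_mul_zetaBar_mul_invNsq, map_one]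

theorem euler_phi : euler (phi : Form n) = fn (∑ j, zeta j * zetaBar j) := by
  simp only [phi, map_sum, euler_smul, euler_dz]
  simp only [smul_eq_fn_mul, ← fn_mul, mul_comm (zeta _)]

theorem eulerBar_phi : eulerBar (phi : Form n) = 0 := by
  simp only [phi, map_sum, eulerBar_smul, eulerBar_dz, smul_zero, Finset.sum_const_zero]

theorem euler_theta : euler (theta : Form n) = 0 := by
  simp only [theta, map_sum, euler_smul, euler_dzb, smul_zero, Finset.sum_const_zero]

theorem eulerBar_theta : eulerBar (theta : Form n) = fn (∑ j, zeta j * zetaBar j) := by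
  simp only [theta, map_sum, eulerBar_smul, eulerBar_dzb]
  simp only [smul_eq_fn_mul, fn_mul]

theorem euler_omega : euler (omega : Form n) = -theta := by
  simp only [omega, theta, map_sum, euler_mul, euler_dzb, euler_dz, zero_mul, zero_add, sgn_dzb,
    neg_mul, ← fn_comm, smul_eq_fn_mul, Finset.sum_neg_distrib]

theorem eulerBar_omega : eulerBar (omega : Form n) = phi := by
  simp only [omega, phi, map_sum, eulerBar_mul, eulerBar_dzb, eulerBar_dz, mul_zero, add_zero,
    smul_eq_fn_mul]

theorem invNsq_mul_invNsq_smul (u : Form n) :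
    (invNsq * invNsq : Sm n) • (fn (∑ j, zeta j * zetaBar j) * u) = (invNsq : Sm n) • u := by
  rw [← smul_eq_fn_mul, smul_smul, mul_assoc, mul_comm invNsq (∑ j, _),
    sum_zeta_mul_zetaBar_mul_invNsq, mul_one]

theorem euler_dlog : euler (dlog : Form n) = 1 := by
  rw [dlog_eq, euler_smul, euler_phi, smul_eq_fn_mul, fn_comm, fn_sum_zeta_mul_zetaBar_mul_invNsq]

theorem eulerBar_dlog : eulerBar (dlog : Form n) = 0 := by
  rw [dlog_eq, eulerBar_smul, eulerBar_phi, smul_zero]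

theorem euler_curv : euler (curv : Form n) = 0 := by
  rw [curv, map_sub, euler_smul, euler_smul, euler_omega, euler_mul, euler_theta, euler_phi,
    sgn_theta, zero_mul, zero_add, ← fn_comm, invNsq_mul_invNsq_smul, sub_self]

theorem eulerBar_curv : eulerBar (curv : Form n) = 0 := by
  rw [curv, map_sub, eulerBar_smul, eulerBar_smul, eulerBar_omega, eulerBar_mul, eulerBar_theta,
    eulerBar_phi, mul_zero, add_zero, invNsq_mul_invNsq_smul, sub_self]

theorem euler_gamma (j : Fin (n + 1)) : euler (gamma j : Form n) = 0 := by
  rw [gamma_eq_sub, map_sub, euler_smul, euler_dz, euler_dlog, smul_one_eq_fn, sub_self]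

theorem eulerBar_gamma (j : Fin (n + 1)) : eulerBar (gamma j : Form n) = 0 := by
  rw [gamma_eq_sub, map_sub, eulerBar_smul, eulerBar_dz, eulerBar_dlog, smul_zero, sub_zero]

/-! ### Scaling, bidegrees and the spaces `𝐋^ν` -/

theorem pull_fn (s t : ℂˣ) (f : Sm n) : pull s t (fn f) = fn (Sm.precomp s t f) := by
  change Sm.precomp s t f ⊗ₜ[ℂ] ExteriorAlgebra.map (covScale s) 1 = _
  rw [map_one]
  rfl

theorem pull_smul (s t : ℂˣ) (f : Sm n) (u : Form n) :
    pull s t (f • u) = Sm.precomp s t f • pull s t u := by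
  rw [smul_eq_fn_mul, map_mul, pull_fn, ← smul_eq_fn_mul]

theorem pull_mul (s t : ℂˣ) (u v : Form n) : pull s t (u * v) = pull s t u * pull s t v :=
  map_mul _ _ _

theorem pull_dz (s t : ℂˣ) (j : Fin (n + 1)) : pull s t (dz j : Form n) = (s : ℂ) • dz j := by
  change Sm.precomp s t 1 ⊗ₜ[ℂ] ExteriorAlgebra.map (covScale s) (eZeta j) = _
  rw [map_one, eZeta, ExteriorAlgebra.map_apply_ι, dz, eZeta, ← TensorProduct.tmul_smul,
    ← map_smul]
  congr 2
  ext i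
  rcases i with i | i <;> simp [covScale, Pi.single_apply]

theorem pull_dzb (s t : ℂˣ) (j : Fin (n + 1)) :
    pull s t (dzb j : Form n) = (starRingEnd ℂ s) • dzb j := by
  change Sm.precomp s t 1 ⊗ₜ[ℂ] ExteriorAlgebra.map (covScale s) (eZetaBar j) = _
  rw [map_one, eZetaBar, ExteriorAlgebra.map_apply_ι, dzb, eZetaBar, ← TensorProduct.tmul_smul,
    ← map_smul]
  congr 2
  ext i
  rcases i with i | i <;> simp [covScale, Pi.single_apply]

theorem pull_phi (s t : ℂˣ) :
    pull s t (phi : Form n) = ((s : ℂ) * starRingEnd ℂ s) • phi := by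
  simp only [phi, map_sum, pull_smul, pull_dz, precomp_zetaBar, Finset.smul_sum]
  refine Finset.sum_congr rfl fun j _ => ?_
  rw [smul_assoc, smul_comm (zetaBar j), smul_smul, mul_comm]

theorem pull_theta (s t : ℂˣ) :
    pull s t (theta : Form n) = ((s : ℂ) * starRingEnd ℂ s) • theta := by
  simp only [theta, map_sum, pull_smul, pull_dzb, precomp_zeta, Finset.smul_sum]
  refine Finset.sum_congr rfl fun j _ => ?_
  rw [smul_assoc, smul_comm (zeta j), smul_smul]

theorem pull_omega (s t : ℂˣ) :
    pull s t (omega : Form n) = ((s : ℂ) * starRingEnd ℂ s) • omega := by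
  simp only [omega, map_sum, pull_mul, pull_dz, pull_dzb, Finset.smul_sum]
  refine Finset.sum_congr rfl fun j _ => ?_
  rw [smul_mul_assoc, mul_smul_comm, smul_smul, mul_comm]

theorem scale_factor_ne_zero (s : ℂˣ) : (s : ℂ) * starRingEnd ℂ s ≠ 0 :=
  mul_ne_zero s.ne_zero (by simp)

theorem pull_dlog (s t : ℂˣ) : pull s t (dlog : Form n) = dlog := by
  rw [dlog_eq, pull_smul, pull_phi, precomp_invNsq, smul_assoc, smul_comm (invNsq : Sm n),
    smul_smul, inv_mul_cancel₀ (scale_factor_ne_zero s), one_smul]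

theorem pull_curv (s t : ℂˣ) : pull s t (curv : Form n) = curv := by
  have h := inv_mul_cancel₀ (scale_factor_ne_zero s)
  rw [curv, map_sub, pull_smul, pull_smul, pull_omega, pull_mul, pull_theta, pull_phi,
    map_mul, precomp_invNsq]
  congr 1
  · rw [smul_assoc, smul_comm (invNsq : Sm n), smul_smul, h, one_smul]
  · rw [smul_mul_smul_comm, smul_mul_smul_comm, smul_assoc,
      smul_comm (invNsq * invNsq : Sm n), smul_smul, mul_mul_mul_comm, h, mul_one, one_smul]

/-- The function part of `α` has degree `-1` in `ζ` and `1` in `z`. -/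
theorem precomp_invNsq_mul_pairing (s t : ℂˣ) :
    Sm.precomp s t (invNsq * pairing : Sm n)
      = ((s : ℂ) ^ (-1 : ℤ) * (t : ℂ) ^ (1 : ℤ)) • (invNsq * pairing) := by
  have hp : Sm.precomp s t (pairing : Sm n) = ((t : ℂ) * starRingEnd ℂ s) • pairing := by
    simp only [pairing, map_sum, map_mul, precomp_zed, precomp_zetaBar, Finset.smul_sum,
      smul_mul_smul_comm]
  rw [map_mul, hp, precomp_invNsq, smul_mul_smul_comm]
  congr 1
  have h1 := s.ne_zero
  have h2 : starRingEnd ℂ (s : ℂ) ≠ 0 := by simp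
  rw [zpow_neg_one, zpow_one]
  field_simp

theorem pull_gamma (s t : ℂˣ) (j : Fin (n + 1)) :
    pull s t (gamma j : Form n) = (s : ℂ) • gamma j := by
  rw [gamma_eq_sub, map_sub, pull_dz, pull_smul, pull_dlog, precomp_zeta, smul_sub, smul_assoc]

/-- The forms of bidegree `(p, q)`. -/
abbrev bidegForm (n p q : ℕ) : Submodule (Sm n) (Form n) := (bideg n p q).baseChange (Sm n)

/-- The generators `dζ_i`, `dζ̄_j` anticommute, so their spans commute as submodules; this makes the
bidegrees additive under multiplication. -/
theorem eZeta_span_mul_comm :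
    Commute (Submodule.span ℂ (Set.range (eZeta (n := n))))
      (Submodule.span ℂ (Set.range (eZetaBar (n := n)))) := by
  have h (i j : Fin (n + 1)) : (eZeta i : Lam n) * eZetaBar j = -(eZetaBar j * eZeta i) :=
    eq_neg_of_add_eq_zero_left (ExteriorAlgebra.ι_add_mul_swap _ _)
  refine le_antisymm ?_ ?_ <;> rw [Submodule.span_mul_span, Submodule.span_le]
  · rintro _ ⟨_, ⟨i, rfl⟩, _, ⟨j, rfl⟩, rfl⟩
    change eZeta i * eZetaBar j ∈ _
    rw [h]
    exact neg_mem (Submodule.mul_mem_mul (Submodule.subset_span ⟨j, rfl⟩)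
      (Submodule.subset_span ⟨i, rfl⟩))
  · rintro _ ⟨_, ⟨i, rfl⟩, _, ⟨j, rfl⟩, rfl⟩
    change eZetaBar i * eZeta j ∈ _
    rw [← neg_neg (eZetaBar i * eZeta j), ← h]
    exact neg_mem (Submodule.mul_mem_mul (Submodule.subset_span ⟨j, rfl⟩)
      (Submodule.subset_span ⟨i, rfl⟩))

theorem bideg_mul (p q p' q' : ℕ) :
    bideg n p q * bideg n p' q' = bideg n (p + p') (q + q') := by
  rw [bideg, bideg, bideg, pow_add, pow_add]
  exact ((eZeta_span_mul_comm (n := n)).pow_pow p' q).symm.mul_mul_mul_comm _ _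

theorem bidegForm_mul {p q p' q' : ℕ} {u v : Form n} (hu : u ∈ bidegForm n p q)
    (hv : v ∈ bidegForm n p' q') : u * v ∈ bidegForm n (p + p') (q + q') := by
  rw [bidegForm, Submodule.baseChange_eq_span] at hu hv
  induction hu using Submodule.span_induction with
  | zero => rw [zero_mul]; exact zero_mem _
  | add x y _ _ hx hy => rw [add_mul]; exact add_mem hx hy
  | smul a x _ hx => rw [smul_mul_assoc]; exact Submodule.smul_mem _ _ hx
  | mem x hx =>
    obtain ⟨x, hx, rfl⟩ := hx
    induction hv using Submodule.span_induction with
    | zero => rw [mul_zero]; exact zero_mem _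
    | add y z _ _ hy hz => rw [mul_add]; exact add_mem hy hz
    | smul a y _ hy => rw [mul_smul_comm]; exact Submodule.smul_mem _ _ hy
    | mem y hy =>
      obtain ⟨y, hy, rfl⟩ := hy
      change (1 : Sm n) ⊗ₜ[ℂ] x * (1 : Sm n) ⊗ₜ[ℂ] y ∈ _
      rw [Algebra.TensorProduct.tmul_mul_tmul]
      refine Submodule.tmul_mem_baseChange_of_mem _ ?_
      rw [← bideg_mul]
      exact Submodule.mul_mem_mul hx hy

theorem fn_mem_bidegForm (f : Sm n) : fn f ∈ bidegForm n 0 0 :=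
  Submodule.tmul_mem_baseChange_of_mem f (by
    rw [bideg, pow_zero, pow_zero, one_mul]
    exact Submodule.one_le.1 le_rfl)

theorem dz_mem_bidegForm (j : Fin (n + 1)) : (dz j : Form n) ∈ bidegForm n 1 0 :=
  Submodule.tmul_mem_baseChange_of_mem 1 (by
    rw [bideg, pow_zero, pow_one, mul_one]
    exact Submodule.subset_span ⟨j, rfl⟩)

theorem dzb_mem_bidegForm (j : Fin (n + 1)) : (dzb j : Form n) ∈ bidegForm n 0 1 :=
  Submodule.tmul_mem_baseChange_of_mem 1 (by
    rw [bideg, pow_zero, pow_one, one_mul]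
    exact Submodule.subset_span ⟨j, rfl⟩)

theorem phi_mem_bidegForm : (phi : Form n) ∈ bidegForm n 1 0 :=
  sum_mem fun j _ => Submodule.smul_mem _ _ (dz_mem_bidegForm j)

theorem theta_mem_bidegForm : (theta : Form n) ∈ bidegForm n 0 1 :=
  sum_mem fun j _ => Submodule.smul_mem _ _ (dzb_mem_bidegForm j)

theorem omega_mem_bidegForm : (omega : Form n) ∈ bidegForm n 1 1 := by
  have h (j : Fin (n + 1)) : dzb j * (dz j : Form n) ∈ bidegForm n (0 + 1) (1 + 0) :=
    bidegForm_mul (dzb_mem_bidegForm j) (dz_mem_bidegForm j)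
  exact Submodule.sum_mem _ fun j _ => h j

theorem curv_mem_bidegForm : (curv : Form n) ∈ bidegForm n 1 1 := by
  have h1 : (invNsq : Sm n) • (omega : Form n) ∈ bidegForm n 1 1 :=
    Submodule.smul_mem _ _ omega_mem_bidegForm
  have h2 : (theta : Form n) * phi ∈ bidegForm n (0 + 1) (1 + 0) :=
    bidegForm_mul theta_mem_bidegForm phi_mem_bidegForm
  exact Submodule.sub_mem _ h1 (Submodule.smul_mem _ _ h2)

theorem gamma_mem_bidegForm (j : Fin (n + 1)) : (gamma j : Form n) ∈ bidegForm n 1 0 := by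
  have h : (dlog : Form n) ∈ bidegForm n 1 0 := by
    rw [dlog_eq]
    exact Submodule.smul_mem _ _ phi_mem_bidegForm
  rw [gamma_eq_sub]
  exact Submodule.sub_mem _ (dz_mem_bidegForm j) (Submodule.smul_mem _ _ h)

theorem projForm_mul {p q p' q' : ℕ} {a b a' b' : ℤ} {u v : Form n}
    (hu : u ∈ projForm n p q a b) (hv : v ∈ projForm n p' q' a' b') :
    u * v ∈ projForm n (p + p') (q + q') (a + a') (b + b') := by
  refine ⟨bidegForm_mul hu.1 hv.1, ?_, ?_, fun s t => ?_⟩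
  · rw [euler_mul, hu.2.1, hv.2.1, zero_mul, mul_zero, add_zero]
  · rw [eulerBar_mul, hu.2.2.1, hv.2.2.1, zero_mul, mul_zero, add_zero]
  · rw [pull_mul, hu.2.2.2, hv.2.2.2, smul_mul_smul_comm, zpow_add₀ s.ne_zero,
      zpow_add₀ t.ne_zero, mul_mul_mul_comm]

theorem fn_mem_projForm {f : Sm n} {a b : ℤ}
    (hf : ∀ s t : ℂˣ, Sm.precomp s t f = ((s : ℂ) ^ a * (t : ℂ) ^ b) • f) :
    fn f ∈ projForm n 0 0 a b :=
  ⟨fn_mem_bidegForm f, euler_fn f, eulerBar_fn f, fun s t => by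
    rw [pull_fn, hf, map_smul]⟩

theorem mem_LL {p q : ℕ} {ν a b a' b' : ℤ} {u : Form n} (hu : u ∈ projForm n p q a' b')
    (hν : (q : ℤ) = p + ν) (ha : a' = a + p) (hb : b' = b - p) : u ∈ LL n ν a b := by
  subst ha hb
  exact Submodule.mem_iSup_of_mem p (Submodule.mem_iSup_of_mem q (Submodule.mem_iSup_of_mem hν hu))

/-- Multiplicativity `𝐋^ν(L) · 𝐋^ν'(L') ⊆ 𝐋^(ν+ν')(L ⊗ L')`. -/
theorem LL_mul_le {ν a b ν' a' b' : ℤ} :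
    LL n ν a b * LL n ν' a' b' ≤ LL n (ν + ν') (a + a') (b + b') := by
  simp only [LL, Submodule.iSup_mul, Submodule.mul_iSup]
  refine iSup_le fun p => iSup_le fun q => iSup_le fun hν => iSup_le fun p' => iSup_le fun q' =>
    iSup_le fun hν' => Submodule.mul_le.2 fun u hu v hv => ?_
  refine mem_LL (projForm_mul hu hv) ?_ ?_ ?_ <;> push_cast <;> lia

theorem LL_mul {ν a b ν' a' b' : ℤ} {u v : Form n} (hu : u ∈ LL n ν a b)
    (hv : v ∈ LL n ν' a' b') : u * v ∈ LL n (ν + ν') (a + a') (b + b') :=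
  LL_mul_le (Submodule.mul_mem_mul hu hv)

theorem fn_mem_LL {f : Sm n} {a b : ℤ}
    (hf : ∀ s t : ℂˣ, Sm.precomp s t f = ((s : ℂ) ^ a * (t : ℂ) ^ b) • f) : fn f ∈ LL n 0 a b :=
  mem_LL (fn_mem_projForm hf) (by simp) (by simp) (by simp)

theorem alpha_mem_LL : (alpha : Form n) ∈ LL n 0 (-1) 1 := by
  rw [alpha_eq]
  refine sub_mem (fn_mem_LL precomp_invNsq_mul_pairing) (Submodule.smul_mem _ _ ?_)
  refine mem_LL (p := 1) (q := 1) (a' := 0) (b' := 0)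
    ⟨curv_mem_bidegForm, euler_curv, eulerBar_curv, fun s t => ?_⟩ (by simp) (by simp) (by simp)
  rw [pull_curv, zpow_zero, zpow_zero, mul_one, one_smul]

theorem gamma_mem_LL (j : Fin (n + 1)) : (gamma j : Form n) ∈ LL n (-1) 0 1 := by
  refine mem_LL (p := 1) (q := 0) (a' := 1) (b' := 0)
    ⟨gamma_mem_bidegForm j, euler_gamma j, eulerBar_gamma j, fun s t => ?_⟩
    (by simp) (by simp) (by simp)
  rw [pull_gamma, zpow_one, zpow_zero, mul_one]

theorem one_mem_LL : (1 : Form n) ∈ LL n 0 0 0 := by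
  rw [← map_one (fn (n := n))]
  exact fn_mem_LL fun s t => by rw [map_one, zpow_zero, zpow_zero, mul_one, one_smul]

theorem LL_pow_le {ν a b : ℤ} (m : ℕ) : LL n ν a b ^ m ≤ LL n (m * ν) (m * a) (m * b) := by
  induction m with
  | zero =>
    rw [pow_zero, Submodule.one_le, Nat.cast_zero, zero_mul, zero_mul, zero_mul]
    exact one_mem_LL
  | succ m ih =>
    rw [pow_succ]
    refine (mul_le_mul' ih le_rfl).trans (LL_mul_le.trans (le_of_eq ?_))
    push_cast
    congr 1 <;> ring

theorem alpha_pow_mem_LL (m : ℕ) : (alpha : Form n) ^ m ∈ LL n 0 (-m) m := by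
  have h := LL_pow_le m (Submodule.pow_mem_pow _ (alpha_mem_LL (n := n)) m)
  simpa using h

/-! ### Holomorphy in `z` -/

theorem map_dZBar_mul (j : Fin (n + 1)) (u v : Form n) :
    TensorProduct.map (dZBar j) LinearMap.id (u * v)
      = TensorProduct.map (dZBar j) LinearMap.id u * v
        + u * TensorProduct.map (dZBar j) LinearMap.id v := by
  induction u using TensorProduct.induction_on with
  | zero => simp only [zero_mul, map_zero, add_zero]
  | add x y hx hy =>
    rw [add_mul, map_add, map_add, hx, hy, add_mul, add_mul]
    abel
  | tmul f x =>
    induction v using TensorProduct.induction_on with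
    | zero => simp only [mul_zero, map_zero, add_zero]
    | add y z hy hz =>
      rw [mul_add, map_add, map_add, hy, hz, mul_add, mul_add]
      abel
    | tmul g y =>
      simp only [TensorProduct.map_tmul, Algebra.TensorProduct.tmul_mul_tmul, LinearMap.id_apply]
      rw [dZBar, wirt_mul, TensorProduct.add_tmul]

/-- The algebra of forms that are holomorphic in `z`. -/
def holForm (n : ℕ) : Subalgebra ℂ (Form n) where
  carrier := {u | HolInZ u}
  mul_mem' {u v} hu hv j := by rw [map_dZBar_mul, hu j, hv j, zero_mul, mul_zero, add_zero]
  add_mem' {u v} hu hv j := by rw [map_add, hu j, hv j, add_zero]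
  algebraMap_mem' c j := by
    change TensorProduct.map (dZBar j) LinearMap.id (algebraMap ℂ (Sm n) c ⊗ₜ[ℂ] (1 : Lam n)) = 0
    rw [TensorProduct.map_tmul, Algebra.algebraMap_eq_smul_one, map_smul, dZBar, wirt_one,
      smul_zero, TensorProduct.zero_tmul]

theorem fn_mem_holForm {f : Sm n} (hf : ∀ j, dZBar j f = 0) : fn f ∈ holForm n := fun j => by
  change TensorProduct.map (dZBar j) LinearMap.id (f ⊗ₜ[ℂ] (1 : Lam n)) = 0
  rw [TensorProduct.map_tmul, hf, TensorProduct.zero_tmul]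

theorem one_tmul_mem_holForm (x : Lam n) : (1 : Sm n) ⊗ₜ[ℂ] x ∈ holForm n := fun j => by
  rw [TensorProduct.map_tmul, dZBar, wirt_one, TensorProduct.zero_tmul]

theorem fn_zeta_mem_holForm (i : Fin (n + 1)) : fn (zeta i) ∈ holForm n :=
  fn_mem_holForm fun _ => wirt_zeta _ _

theorem fn_zed_mem_holForm (i : Fin (n + 1)) : fn (zed i) ∈ holForm n :=
  fn_mem_holForm fun _ => wirt_zed _ _

theorem fn_zetaBar_mem_holForm (i : Fin (n + 1)) : fn (zetaBar i) ∈ holForm n :=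
  fn_mem_holForm fun j => by
    simp only [dZBar, wirt_zetaBar, Pi.zero_apply, map_zero]

theorem fn_invNsq_mem_holForm : fn invNsq ∈ holForm n :=
  fn_mem_holForm fun j => by
    simp only [dZBar, wirt_invNsq, Pi.zero_apply, map_zero, zero_mul, Finset.sum_const_zero,
      mul_zero, neg_zero]

theorem smul_mem_holForm {f : Sm n} {u : Form n} (hf : fn f ∈ holForm n) (hu : u ∈ holForm n) :
    f • u ∈ holForm n := by
  rw [smul_eq_fn_mul]
  exact mul_mem hf hu

theorem phi_mem_holForm : phi ∈ holForm n :=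
  sum_mem fun j _ => smul_mem_holForm (fn_zetaBar_mem_holForm j) (one_tmul_mem_holForm _)

theorem theta_mem_holForm : theta ∈ holForm n :=
  sum_mem fun j _ => smul_mem_holForm (fn_zeta_mem_holForm j) (one_tmul_mem_holForm _)

theorem omega_mem_holForm : omega ∈ holForm n :=
  sum_mem fun _ _ => mul_mem (one_tmul_mem_holForm _) (one_tmul_mem_holForm _)

theorem curv_mem_holForm : curv ∈ holForm n := by
  have h : fn (invNsq * invNsq) ∈ holForm n := by
    rw [fn_mul]
    exact mul_mem fn_invNsq_mem_holForm fn_invNsq_mem_holForm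
  exact sub_mem (smul_mem_holForm fn_invNsq_mem_holForm omega_mem_holForm)
    (smul_mem_holForm h (mul_mem theta_mem_holForm phi_mem_holForm))

theorem alpha_mem_holForm : alpha ∈ holForm n := by
  rw [alpha_eq, fn_mul, pairing, map_sum]
  refine sub_mem (mul_mem fn_invNsq_mem_holForm (sum_mem fun j _ => ?_))
    (Subalgebra.smul_mem _ curv_mem_holForm _)
  rw [fn_mul]
  exact mul_mem (fn_zed_mem_holForm j) (fn_zetaBar_mem_holForm j)

theorem gamma_mem_holForm (j : Fin (n + 1)) : gamma j ∈ holForm n := by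
  rw [gamma_eq_sub, dlog_eq]
  exact sub_mem (one_tmul_mem_holForm _) (smul_mem_holForm (fn_zeta_mem_holForm j)
    (smul_mem_holForm fn_invNsq_mem_holForm phi_mem_holForm))

/-! ### The substitution `τ^*` -/

/-- The value of the substitution `w = α ζ` on the monomial `w^A z^B`, `m = (A, B)`. -/
def substMon (m : (Fin (n + 1) ⊕ Fin (n + 1)) →₀ ℕ) : Form n :=
  alpha ^ (∑ j, m (Sum.inl j)) *
    fn ((∏ j, zeta j ^ m (Sum.inl j)) * ∏ j, zed j ^ m (Sum.inr j))

theorem substW_monomial (m : (Fin (n + 1) ⊕ Fin (n + 1)) →₀ ℕ) (c : ℂ) :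
    substW (MvPolynomial.monomial m c) = c • (substMon m : Form n) := by
  have h : (MvPolynomial.basisMonomials (Fin (n + 1) ⊕ Fin (n + 1)) ℂ).repr
      (MvPolynomial.monomial m c) = Finsupp.single m c := rfl
  rw [substW, LinearMap.comp_apply, LinearEquiv.coe_coe, h, Finsupp.lsum_single,
    LinearMap.toSpanSingleton_apply]
  rfl

/-- To show that `substW p` lies in a subspace it suffices to treat monomials. -/
theorem substW_mem {S : Submodule ℂ (Form n)} {p : WZ n}
    (h : ∀ m ∈ p.support, substMon m ∈ S) : substW p ∈ S := by
  rw [p.as_sum, map_sum]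
  refine Submodule.sum_mem _ fun m hm => ?_
  rw [substW_monomial]
  exact Submodule.smul_mem _ _ (h m hm)

theorem alpha_pow_mul (m : ℕ) (u : Form n) : alpha ^ m * u = u * alpha ^ m :=
  (show Commute alpha u from alpha_mul u).pow_left m

/-- As `α` is central, so are all values of the substitution on polynomials. -/
theorem substMon_mul (m : (Fin (n + 1) ⊕ Fin (n + 1)) →₀ ℕ) (u : Form n) :
    substMon m * u = u * substMon m := by
  rw [substMon, mul_assoc, fn_comm, ← mul_assoc, alpha_pow_mul, mul_assoc]

theorem substW_mul_comm (p : WZ n) (u : Form n) : substW p * u = u * substW p := by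
  have h : substW p ∈ LinearMap.ker (LinearMap.mulRight ℂ u - LinearMap.mulLeft ℂ u) :=
    substW_mem fun m _ => sub_eq_zero.2 (substMon_mul m u)
  exact sub_eq_zero.1 h

theorem substMon_add (m m' : (Fin (n + 1) ⊕ Fin (n + 1)) →₀ ℕ) :
    (substMon (m + m') : Form n) = substMon m * substMon m' := by
  have h : (fn ((∏ j, zeta j ^ (m + m') (Sum.inl j)) * ∏ j, zed j ^ (m + m') (Sum.inr j)) : Form n)
      = fn ((∏ j, zeta j ^ m (Sum.inl j)) * ∏ j, zed j ^ m (Sum.inr j))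
        * fn ((∏ j, zeta j ^ m' (Sum.inl j)) * ∏ j, zed j ^ m' (Sum.inr j)) := by
    rw [← fn_mul]
    simp only [Finsupp.add_apply, pow_add, Finset.prod_mul_distrib]
    rw [mul_mul_mul_comm]
  rw [substMon, h]
  simp only [Finsupp.add_apply, Finset.sum_add_distrib, pow_add]
  rw [mul_assoc, ← mul_assoc (alpha ^ _) (fn _), alpha_pow_mul (∑ j, m' (Sum.inl j)), mul_assoc,
    ← mul_assoc, ← substMon, ← substMon]

theorem substW_mul (p q : WZ n) : substW (p * q) = (substW p * substW q : Form n) := by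
  induction p using MvPolynomial.induction_on' with
  | add p p' hp hp' => rw [add_mul, map_add, map_add, hp, hp', add_mul]
  | monomial m c =>
    induction q using MvPolynomial.induction_on' with
    | add q q' hq hq' => rw [mul_add, map_add, map_add, hq, hq', mul_add]
    | monomial m' c' =>
      rw [MvPolynomial.monomial_mul, substW_monomial, substW_monomial, substW_monomial,
        substMon_add, smul_mul_smul_comm]

theorem substW_one : substW (1 : WZ n) = (1 : Form n) := by
  rw [MvPolynomial.one_def, substW_monomial, one_smul, substMon]
  simp

theorem substW_X_inl (j : Fin (n + 1)) :
    substW (MvPolynomial.X (Sum.inl j) : WZ n) = (alpha * fn (zeta j) : Form n) := by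
  rw [MvPolynomial.X, substW_monomial, one_smul, substMon]
  congr 1
  · simp [Finsupp.single_apply, Sum.inl.injEq]
  · simp [Finsupp.single_apply, Sum.inl.injEq, pow_ite]

theorem substW_X_inr (j : Fin (n + 1)) :
    substW (MvPolynomial.X (Sum.inr j) : WZ n) = (fn (zed j) : Form n) := by
  rw [MvPolynomial.X, substW_monomial, one_smul, substMon]
  simp [Finsupp.single_apply]

theorem tau_tmul (p : WZ n) (x : LamW n) : tau (p ⊗ₜ[ℂ] x) = substW p * substDw x := rfl

theorem tau_one : tau (1 : PForm n) = 1 := by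
  change tau ((1 : WZ n) ⊗ₜ[ℂ] (1 : LamW n)) = 1
  rw [tau_tmul, substW_one, map_one, mul_one]

theorem tau_smul (p : WZ n) (u : PForm n) : tau (p • u) = substW p * tau u := by
  induction u using TensorProduct.induction_on with
  | zero => rw [smul_zero, map_zero, mul_zero]
  | add x y hx hy => rw [smul_add, map_add, map_add, hx, hy, mul_add]
  | tmul q x =>
    rw [TensorProduct.smul_tmul', smul_eq_mul, tau_tmul, tau_tmul, substW_mul, mul_assoc]

theorem substDw_ι (v : Fin (n + 1) → ℂ) :
    substDw (ExteriorAlgebra.ι ℂ v) = (∑ j, v j • gamma j : Form n) := by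
  rw [substDw, ExteriorAlgebra.lift_ι_apply, Fintype.linearCombination_apply]

theorem sgn_substMon (m : (Fin (n + 1) ⊕ Fin (n + 1)) →₀ ℕ) :
    sgn (substMon m : Form n) = substMon m := by
  rw [substMon, map_mul (sgn (n := n)), map_pow (sgn (n := n)), sgn_alpha, sgn_fn]

theorem sgn_substW (p : WZ n) : sgn (substW p : Form n) = substW p := by
  have h : substW p ∈ LinearMap.ker ((sgn (n := n)).toLinearMap - LinearMap.id) :=
    substW_mem fun m _ => sub_eq_zero.2 (sgn_substMon m)
  exact sub_eq_zero.1 h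

theorem sgn_mul (u v : Form n) : sgn (u * v) = sgn u * sgn v := map_mul _ _ _

theorem sgn_substDw_ι (v : Fin (n + 1) → ℂ) :
    sgn (substDw (ExteriorAlgebra.ι ℂ v) : Form n) = -substDw (ExteriorAlgebra.ι ℂ v) := by
  simp only [substDw_ι, map_sum, map_smul, sgn_gamma, smul_neg, Finset.sum_neg_distrib]

theorem sgn_substDw (x : LamW n) :
    sgn (substDw x : Form n) = substDw (CliffordAlgebra.involute x) := by
  induction x using CliffordAlgebra.left_induction with
  | algebraMap r => rw [AlgHom.commutes, AlgHom.commutes, AlgHom.commutes, AlgHom.commutes]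
  | add x y hx hy => rw [map_add, map_add, map_add, map_add, hx, hy]
  | ι_mul x m hx =>
    rw [map_mul, sgn_mul, hx, map_mul, CliffordAlgebra.involute_ι, map_mul, map_neg,
      sgn_substDw_ι m]

theorem tau_psgn (u : PForm n) : tau (psgn u) = sgn (tau u) := by
  induction u using TensorProduct.induction_on with
  | zero => rw [map_zero, map_zero, map_zero]
  | add x y hx hy => rw [map_add, map_add, map_add, map_add, hx, hy]
  | tmul p x =>
    rw [tau_tmul, sgn_mul, sgn_substW, sgn_substDw]
    rfl

/-! ### `τ^*` intertwines `δ_{z-w}` and `∇_η` -/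

theorem nablaEta_mul (u v : Form n) : nablaEta (u * v) = nablaEta u * v + sgn u * nablaEta v :=
  isAntiDer_nablaEta u v

theorem nablaEta_fn_mul_eq_zero {f g : Sm n} (hf : nablaEta (fn f) = 0)
    (hg : nablaEta (fn g) = 0) : nablaEta (fn (f * g)) = 0 := by
  rw [fn_mul, nablaEta_mul, hf, hg, zero_mul, mul_zero, add_zero]

theorem nablaEta_fn_zeta (j : Fin (n + 1)) : nablaEta (fn (zeta j)) = 0 := by
  rw [nablaEta, LinearMap.sub_apply, deltaEta_fn, dbar_fn_zeta, sub_zero]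

theorem nablaEta_fn_zed (j : Fin (n + 1)) : nablaEta (fn (zed j)) = 0 := by
  rw [nablaEta, LinearMap.sub_apply, deltaEta_fn, dbar_fn_zed, sub_zero]

theorem nablaEta_fn_prod_pow {F : Fin (n + 1) → Sm n} (hF : ∀ j, nablaEta (fn (F j)) = 0)
    (m : Fin (n + 1) → ℕ) : nablaEta (fn (∏ j, F j ^ m j)) = 0 := by
  refine Finset.prod_induction _ (fun f : Sm n => nablaEta (fn f) = 0)
    (fun _ _ => nablaEta_fn_mul_eq_zero) ?_ fun j _ => ?_
  · rw [map_one, isAntiDer_nablaEta.one]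
  · rw [map_pow fn]
    exact isAntiDer_nablaEta.pow_eq_zero (hF j) _

theorem nablaEta_substMon (m : (Fin (n + 1) ⊕ Fin (n + 1)) →₀ ℕ) :
    nablaEta (substMon m : Form n) = 0 := by
  rw [substMon, nablaEta_mul, isAntiDer_nablaEta.pow_eq_zero nablaEta_alpha,
    nablaEta_fn_mul_eq_zero (nablaEta_fn_prod_pow nablaEta_fn_zeta _)
      (nablaEta_fn_prod_pow nablaEta_fn_zed _), zero_mul, mul_zero, add_zero]

theorem nablaEta_substW (p : WZ n) : nablaEta (substW p : Form n) = 0 := by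
  have h : substW p ∈ LinearMap.ker (nablaEta (n := n)) := substW_mem fun m _ => nablaEta_substMon m
  exact h

/-- The image of `z_j - w_j` under the substitution. -/
def zSub (j : Fin (n + 1)) : Form n := fn (zed j) - alpha * fn (zeta j)

theorem substW_sub (j : Fin (n + 1)) :
    substW (MvPolynomial.X (Sum.inr j) - MvPolynomial.X (Sum.inl j) : WZ n)
      = (zSub j : Form n) := by
  rw [map_sub, substW_X_inl, substW_X_inr, zSub]

theorem mul_zSub (j : Fin (n + 1)) (u : Form n) : u * zSub j = zSub j * u := by
  rw [← substW_sub, substW_mul_comm]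

/-- Interior multiplication by `∂/∂w_j` on forms with constant coefficients. -/
def contrW (j : Fin (n + 1)) : LamW n →ₗ[ℂ] LamW n :=
  CliffordAlgebra.contractLeft (Q := (0 : QuadraticForm ℂ (Fin (n + 1) → ℂ))) (LinearMap.proj j)

theorem substDw_mul (x y : LamW n) : (substDw (x * y) : Form n) = substDw x * substDw y :=
  map_mul _ _ _

theorem nablaEta_substDw_ι (v : Fin (n + 1) → ℂ) :
    nablaEta (substDw (ExteriorAlgebra.ι ℂ v) : Form n)
      = (2 * Real.pi * Complex.I : ℂ) • ∑ j, v j • zSub j := by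
  simp only [substDw_ι, map_sum, map_smul, nablaEta_gamma, Finset.smul_sum, zSub]
  exact Finset.sum_congr rfl fun j _ => smul_comm _ _ _

/-- The identity `∇_η τ^* = τ^* δ_{z-w}` on forms with constant coefficients. -/
theorem nablaEta_substDw (x : LamW n) : nablaEta (substDw x : Form n)
    = (2 * Real.pi * Complex.I : ℂ) • ∑ j, zSub j * substDw (contrW j x) := by
  induction x using CliffordAlgebra.left_induction with
  | algebraMap r =>
    have h (j : Fin (n + 1)) : contrW j (algebraMap ℂ (LamW n) r) = 0 :=
      CliffordAlgebra.contractLeft_algebraMap _ _ _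
    change nablaEta (substDw (algebraMap ℂ (LamW n) r)) = (2 * Real.pi * Complex.I : ℂ) •
      ∑ j, zSub j * substDw (contrW j (algebraMap ℂ (LamW n) r))
    simp only [h, map_zero, mul_zero, Finset.sum_const_zero, smul_zero]
    rw [AlgHom.commutes, Algebra.algebraMap_eq_smul_one, map_smul, isAntiDer_nablaEta.one,
      smul_zero]
  | add x y hx hy =>
    simp only [map_add, hx, hy, mul_add, Finset.sum_add_distrib, smul_add]
  | ι_mul x v hx =>
    have h (j : Fin (n + 1)) : contrW j (ExteriorAlgebra.ι ℂ v * x)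
        = v j • x - ExteriorAlgebra.ι ℂ v * contrW j x :=
      CliffordAlgebra.contractLeft_ι_mul _ _ _
    change nablaEta (substDw (ExteriorAlgebra.ι ℂ v * x)) = (2 * Real.pi * Complex.I : ℂ) •
      ∑ j, zSub j * substDw (contrW j (ExteriorAlgebra.ι ℂ v * x))
    rw [substDw_mul, nablaEta_mul, nablaEta_substDw_ι, hx, sgn_substDw_ι, smul_mul_assoc,
      mul_smul_comm, ← smul_add, Finset.sum_mul, Finset.mul_sum, ← Finset.sum_add_distrib]
    refine congrArg _ (Finset.sum_congr rfl fun j _ => ?_)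
    rw [h, map_sub, map_smul, substDw_mul, mul_sub, smul_mul_assoc, mul_smul_comm, neg_mul,
      ← mul_assoc (substDw _), mul_zSub, mul_assoc, sub_eq_add_neg]

theorem deltaZW_tmul (p : WZ n) (x : LamW n) : deltaZW (p ⊗ₜ[ℂ] x)
    = (2 * Real.pi * Complex.I : ℂ) • ∑ j : Fin (n + 1),
      ((MvPolynomial.X (Sum.inr j) - MvPolynomial.X (Sum.inl j)) * p) ⊗ₜ[ℂ] contrW j x := by
  simp only [deltaZW, LinearMap.smul_apply, LinearMap.sum_apply, TensorProduct.map_tmul,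
    LinearMap.mulLeft_apply]
  rfl

/-- `∇_η ∘ τ^* = τ^* ∘ δ_{z-w}`. -/
theorem nablaEta_tau (u : PForm n) : nablaEta (tau u) = tau (deltaZW u) := by
  induction u using TensorProduct.induction_on with
  | zero => simp only [map_zero]
  | add x y hx hy => simp only [map_add, hx, hy]
  | tmul p x =>
    rw [tau_tmul, nablaEta_mul, nablaEta_substW, zero_mul, zero_add, sgn_substW, nablaEta_substDw,
      deltaZW_tmul, map_smul, map_sum, mul_smul_comm, Finset.mul_sum]
    refine congrArg _ (Finset.sum_congr rfl fun j _ => ?_)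
    rw [tau_tmul, substW_mul, substW_sub, ← mul_assoc, mul_zSub]

/-! ### Homogeneity of the substituted forms -/

theorem homPoly_le {σ : Type} {e : ℤ} {S : Submodule ℂ (MvPolynomial σ ℂ)}
    (h : ∀ m : ℕ, (m : ℤ) = e → MvPolynomial.homogeneousSubmodule σ ℂ m ≤ S) :
    homPoly σ e ≤ S :=
  iSup_le fun m => iSup_le fun hm => h m hm

theorem eq_zero_of_mem_homPoly {σ : Type} {e : ℤ} (he : e < 0) {p : MvPolynomial σ ℂ}
    (hp : p ∈ homPoly σ e) : p = 0 :=
  homPoly_le (S := ⊥) (fun m hm => by lia) hp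

theorem sum_eq_of_mem_support {σ : Type} [Fintype σ] {k : ℕ} {p : MvPolynomial σ ℂ}
    (hp : p.IsHomogeneous k) {m : σ →₀ ℕ} (hm : m ∈ p.support) : ∑ i, m i = k := by
  rw [← Finsupp.degree_eq_sum, Finsupp.degree_eq_weight_one]
  exact hp (MvPolynomial.mem_support_iff.1 hm)

theorem precomp_prod_pow {F : Fin (n + 1) → Sm n} {s t : ℂˣ} {c : ℂ}
    (hF : ∀ j, Sm.precomp s t (F j) = c • F j) (m : Fin (n + 1) → ℕ) :
    Sm.precomp s t (∏ j, F j ^ m j) = c ^ (∑ j, m j) • ∏ j, F j ^ m j := by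
  simp only [map_prod, map_pow, hF, smul_pow, Finset.prod_smul, Finset.prod_pow_eq_pow_sum]

/-- The degree `|A|` in `ζ` of `ζ^A` cancels against that of `α^|A|`, which adds `|A|` to the degree
in `z`. -/
theorem substMon_mem_LL (m : (Fin (n + 1) ⊕ Fin (n + 1)) →₀ ℕ) :
    (substMon m : Form n) ∈ LL n 0 0 (∑ i, m i : ℕ) := by
  have h : fn ((∏ j, zeta j ^ m (Sum.inl j)) * ∏ j, zed j ^ m (Sum.inr j))
      ∈ LL n 0 (∑ j, m (Sum.inl j) : ℕ) (∑ j, m (Sum.inr j) : ℕ) :=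
    fn_mem_LL fun s t => by
      rw [map_mul, precomp_prod_pow (precomp_zeta s t), precomp_prod_pow (precomp_zed s t),
        smul_mul_smul_comm, zpow_natCast, zpow_natCast]
  have h2 := LL_mul (alpha_pow_mem_LL (n := n) (∑ j, m (Sum.inl j))) h
  rw [add_zero, neg_add_cancel, ← Nat.cast_add, ← Fintype.sum_sum_type] at h2
  exact h2

theorem substW_mem_LL {e : ℤ} {p : WZ n} (hp : p ∈ homPoly _ e) :
    (substW p : Form n) ∈ LL n 0 0 e := by
  refine homPoly_le (S := (LL n 0 0 e).comap substW) (fun k hk q hq => ?_) hp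
  change substW q ∈ LL n 0 0 e
  refine substW_mem fun m hm => ?_
  rw [← hk, ← sum_eq_of_mem_support hq hm]
  exact substMon_mem_LL m

theorem substDw_mem_LL {m : ℕ} {x : LamW n} (hx : x ∈ ⋀[ℂ]^m (Fin (n + 1) → ℂ)) :
    (substDw x : Form n) ∈ LL n (-m) 0 m := by
  have h : (LinearMap.range (ExteriorAlgebra.ι ℂ (M := Fin (n + 1) → ℂ))).map
      (substDw (n := n)).toLinearMap ≤ LL n (-1) 0 1 := by
    rintro _ ⟨_, ⟨v, rfl⟩, rfl⟩
    change substDw (ExteriorAlgebra.ι ℂ v) ∈ _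
    rw [substDw_ι]
    exact Submodule.sum_mem _ fun j _ => Submodule.smul_mem _ _ (gamma_mem_LL j)
  have h2 : substDw x ∈ ((LinearMap.range (ExteriorAlgebra.ι ℂ (M := Fin (n + 1) → ℂ))).map
      (substDw (n := n)).toLinearMap) ^ m := by
    rw [← Submodule.map_pow]
    exact Submodule.mem_map_of_mem hx
  simpa using LL_pow_le m (pow_le_pow_left' h m h2)

theorem tau_mem_LL {m : ℕ} {e : ℤ} {u : PForm n} (hu : u ∈ homPForm n m e) :
    tau u ∈ LL n (-m) 0 (e + m) := by
  obtain ⟨u, rfl⟩ := hu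
  induction u using TensorProduct.induction_on with
  | zero => rw [map_zero, map_zero]; exact zero_mem _
  | add x y hx hy => rw [map_add, map_add]; exact add_mem hx hy
  | tmul p x =>
    rw [TensorProduct.map_tmul, tau_tmul]
    simpa using LL_mul (substW_mem_LL p.2) (substDw_mem_LL x.2)

theorem tau_mem_holForm (u : PForm n) : tau u ∈ holForm n := by
  induction u using TensorProduct.induction_on with
  | zero => rw [map_zero]; exact zero_mem _
  | add x y hx hy => rw [map_add]; exact add_mem hx hy
  | tmul p x =>
    rw [tau_tmul]
    have h1 : substW p ∈ Subalgebra.toSubmodule (holForm n) := substW_mem fun m _ => by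
      have h : (∏ j, zeta j ^ m (Sum.inl j)) * ∏ j, zed j ^ m (Sum.inr j)
          ∈ (holForm n).comap fn := by
        have h1 (j : Fin (n + 1)) : zeta j ∈ (holForm n).comap fn := fn_zeta_mem_holForm j
        have h2 (j : Fin (n + 1)) : zed j ∈ (holForm n).comap fn := fn_zed_mem_holForm j
        exact mul_mem (prod_mem fun j _ => pow_mem (h1 j) _) (prod_mem fun j _ => pow_mem (h2 j) _)
      exact (holForm n).mul_mem (pow_mem alpha_mem_holForm _) h
    have h2 : substDw x ∈ holForm n := by
      induction x using CliffordAlgebra.left_induction with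
      | algebraMap r => rw [AlgHom.commutes]; exact Subalgebra.algebraMap_mem _ _
      | add x y hx hy => rw [map_add]; exact add_mem hx hy
      | ι_mul x v hx =>
        rw [map_mul]
        refine mul_mem ?_ hx
        change substDw (ExteriorAlgebra.ι ℂ v) ∈ _
        rw [substDw_ι]
        exact sum_mem fun j _ => Subalgebra.smul_mem _ (gamma_mem_holForm j) _
    exact mul_mem h1 h2

/-- A form of degree `e` in `w` becomes `α^e` times its value at `ζ`. -/
theorem substW_atW {e : ℤ} {p : MvPolynomial (Fin (n + 1)) ℂ} (hp : p ∈ homPoly _ e) :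
    (substW (atW p) : Form n) = alpha ^ e.toNat * fn (atZeta p) := by
  let A : MvPolynomial (Fin (n + 1)) ℂ →ₗ[ℂ] Form n := substW ∘ₗ atW.toLinearMap
  let B : MvPolynomial (Fin (n + 1)) ℂ →ₗ[ℂ] Form n :=
    LinearMap.mulLeft ℂ (alpha ^ e.toNat : Form n) ∘ₗ (fn.comp atZeta).toLinearMap
  have h : p ∈ LinearMap.eqLocus A B := by
    refine homPoly_le (fun k hk q hq => ?_) hp
    rw [q.as_sum]
    refine Submodule.sum_mem _ fun m hm => ?_
    have hm := sum_eq_of_mem_support hq hm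
    change substW (atW (MvPolynomial.monomial m (q.coeff m)))
      = alpha ^ e.toNat * fn (atZeta (MvPolynomial.monomial m (q.coeff m)))
    have h1 (j : Fin (n + 1)) : Finsupp.mapDomain Sum.inl m (Sum.inl j : _ ⊕ Fin (n + 1)) = m j :=
      Finsupp.mapDomain_apply Sum.inl_injective _ _
    have h2 (j : Fin (n + 1)) : Finsupp.mapDomain Sum.inl m (Sum.inr j : Fin (n + 1) ⊕ _) = 0 :=
      Finsupp.mapDomain_of_notMem_range _ _ (by simp)
    rw [atW, MvPolynomial.rename_monomial, substW_monomial, substMon, atZeta,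
      MvPolynomial.aeval_monomial, ← hk, Int.toNat_natCast, ← hm, ← Algebra.smul_def, map_smul,
      mul_smul_comm, Finsupp.prod_fintype _ _ fun _ => pow_zero _]
    simp only [h1, h2, pow_zero, Finset.prod_const_one, mul_one]
  exact h

theorem substW_atZ (p : MvPolynomial (Fin (n + 1)) ℂ) :
    (substW (atZ p) : Form n) = fn (atZed p) := by
  induction p using MvPolynomial.induction_on with
  | C a =>
    rw [← MvPolynomial.algebraMap_eq, AlgHom.commutes, AlgHom.commutes, AlgHom.commutes,
      Algebra.algebraMap_eq_smul_one, Algebra.algebraMap_eq_smul_one, map_smul, substW_one]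
  | add p q hp hq => rw [map_add, map_add, map_add, map_add, hp, hq]
  | mul_X p j hp =>
    rw [map_mul, substW_mul, hp, map_mul, fn_mul, atZ, MvPolynomial.rename_X, substW_X_inr, atZed,
      MvPolynomial.aeval_X]

/-! ### The component of bidegree `(0, 0)` -/

/-- The projection `comp00` as a homomorphism of algebras. -/
def comp00Hom : Form n →ₐ[ℂ] Sm n :=
  (Algebra.TensorProduct.rid ℂ ℂ (Sm n)).toAlgHom.comp
    (Algebra.TensorProduct.map (AlgHom.id ℂ (Sm n)) ExteriorAlgebra.algebraMapInv)

theorem comp00_eq (u : Form n) : comp00 u = comp00Hom u := by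
  induction u using TensorProduct.induction_on with
  | zero => rw [map_zero, map_zero]
  | add x y hx hy => rw [map_add, map_add, hx, hy]
  | tmul f x => rfl

theorem comp00Hom_mul (u v : Form n) : comp00Hom (u * v) = comp00Hom u * comp00Hom v :=
  map_mul _ _ _

theorem comp00Hom_tmul_ι (f : Sm n) (v : Cov n) :
    comp00Hom (f ⊗ₜ[ℂ] ExteriorAlgebra.ι ℂ v) = 0 := by
  change (Algebra.TensorProduct.rid ℂ ℂ (Sm n))
    (f ⊗ₜ[ℂ] ExteriorAlgebra.algebraMapInv (ExteriorAlgebra.ι ℂ v)) = 0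
  rw [ExteriorAlgebra.algebraMapInv, ExteriorAlgebra.lift_ι_apply, LinearMap.zero_apply,
    TensorProduct.tmul_zero, map_zero]

theorem comp00Hom_fn (f : Sm n) : comp00Hom (fn f) = f := by
  change (Algebra.TensorProduct.rid ℂ ℂ (Sm n)) (f ⊗ₜ[ℂ] ExteriorAlgebra.algebraMapInv 1) = f
  rw [map_one, Algebra.TensorProduct.rid_tmul, one_smul]

theorem comp00Hom_alpha : comp00Hom (alpha : Form n) = invNsq * pairing := by
  have h1 (j : Fin (n + 1)) : comp00Hom (dzb j : Form n) = 0 := comp00Hom_tmul_ι _ _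
  have h2 : comp00Hom (theta : Form n) = 0 := by
    simp only [theta, map_sum, smul_eq_fn_mul, comp00Hom_mul, h1, mul_zero,
      Finset.sum_const_zero]
  have h3 : comp00Hom (omega : Form n) = 0 := by
    simp only [omega, map_sum, comp00Hom_mul, h1, zero_mul, Finset.sum_const_zero]
  rw [alpha_eq, curv, smul_eq_fn_mul, smul_eq_fn_mul, map_sub, map_smul, map_sub, comp00Hom_fn,
    comp00Hom_mul, comp00Hom_mul (fn (invNsq * invNsq : Sm n)), comp00Hom_mul (theta : Form n),
    h2, h3, zero_mul, mul_zero, mul_zero, sub_zero, smul_zero, sub_zero]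

/-- On the diagonal the function part of `α` is `1`. -/
theorem invNsq_mul_pairing_diag (x : Fin (n + 1) → ℂ) (hx : x ≠ 0) :
    (invNsq * pairing : Sm n).1 ⟨(x, x), hx, hx⟩ = 1 := by
  have h : (∑ j, zeta j * zetaBar j : Sm n).1 ⟨(x, x), hx, hx⟩
      = (pairing : Sm n).1 ⟨(x, x), hx, hx⟩ := by
    simp only [pairing, AddSubmonoidClass.coe_finsetSum, Finset.sum_apply]
    rfl
  have h2 := congrArg (fun f : Sm n => f.1 ⟨(x, x), hx, hx⟩)
    (sum_zeta_mul_zetaBar_mul_invNsq (n := n))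
  change (∑ j, zeta j * zetaBar j : Sm n).1 ⟨(x, x), hx, hx⟩ * (invNsq : Sm n).1 _ = 1 at h2
  rw [h, mul_comm] at h2
  exact h2

/-! ### The entries of `heferOf` -/

section

variable {E : LineComplex n} {κ : ℤ} {h : ∀ k l, Matrix (Fin (E.r l)) (Fin (E.r k)) (PForm n)}

theorem heferOf_of_lt (hh : IsPolyHefer E h) {k l : ℕ} (hkl : k < l) : heferOf E κ h k l = 0 := by
  ext i j
  rw [heferOf, hh.eq_zero k l hkl, Matrix.zero_apply, map_zero, zero_mul, Matrix.zero_apply]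

theorem heferOf_self (hh : IsPolyHefer E h) (l : ℕ) (i j : Fin (E.r l)) :
    heferOf E κ h l l i j = if i = j then alpha ^ (κ - E.d l j).toNat else 0 := by
  rw [heferOf, hh.eq_one, Matrix.one_apply]
  split_ifs
  · rw [tau_one, one_mul]
  · rw [map_zero, zero_mul]

theorem heferOf_mem_LL (hκ : ∀ k j, E.d k j ≤ κ) (hh : IsPolyHefer E h) (k l : ℕ)
    (i : Fin (E.r l)) (j : Fin (E.r k)) :
    heferOf E κ h k l i j ∈ LL n (-(k : ℤ) + l) (E.d k j - κ) (-(E.d l i - κ)) := by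
  rcases lt_or_ge k l with hkl | hkl
  · rw [heferOf_of_lt hh hkl]
    exact zero_mem _
  · have h1 := LL_mul (tau_mem_LL (hh.mem k l hkl i j)) (alpha_pow_mem_LL (κ - E.d k j).toNat)
    have h2 : ((κ - E.d k j).toNat : ℤ) = κ - E.d k j :=
      Int.toNat_of_nonneg (by linarith [hκ k j])
    rw [h2, Nat.cast_sub hkl] at h1
    rw [heferOf]
    convert h1 using 2 <;> ring

theorem holInZ_heferOf (k l : ℕ) (i : Fin (E.r l)) (j : Fin (E.r k)) :
    HolInZ (heferOf E κ h k l i j) :=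
  (holForm n).mul_mem (tau_mem_holForm (h k l i j)) ((holForm n).pow_mem alpha_mem_holForm _)

theorem comp00_heferOf_diag (hh : IsPolyHefer E h) (l : ℕ) (i j : Fin (E.r l))
    (x : Fin (n + 1) → ℂ) (hx : x ≠ 0) :
    (comp00 (heferOf E κ h l l i j)).1 ⟨(x, x), hx, hx⟩ = if i = j then 1 else 0 := by
  rw [heferOf_self hh]
  split_ifs
  · rw [comp00_eq, map_pow (comp00Hom (n := n)), comp00Hom_alpha]
    change ((invNsq * pairing : Sm n).1 ⟨(x, x), hx, hx⟩) ^ _ = 1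
    rw [invNsq_mul_pairing_diag x hx, one_pow]
  · rw [map_zero]
    rfl

theorem nablaEta_alpha_pow (m : ℕ) : nablaEta ((alpha : Form n) ^ m) = 0 :=
  isAntiDer_nablaEta.pow_eq_zero nablaEta_alpha _

/-- The relation `∇_η H_k^ℓ = H_{k-1}^ℓ f_k - f_{ℓ+1}(z) H_k^{ℓ+1}`, the image under `τ^*` of the
relation for `h_k^ℓ`. -/
theorem nablaEta_heferOf_succ (hκ : ∀ k j, E.d k j ≤ κ) (hh : IsPolyHefer E h) (k l : ℕ)
    (i : Fin (E.r l)) (j : Fin (E.r (k + 1))) :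
    nablaEta (heferOf E κ h (k + 1) l i j)
      = ∑ ν, atZeta (E.f k ν j) • heferOf E κ h k l i ν
        - ∑ ν, atZed (E.f l i ν) • sgn (heferOf E κ h (k + 1) (l + 1) ν j) := by
  simp only [heferOf]
  rw [nablaEta_mul, nablaEta_alpha_pow, mul_zero, add_zero, nablaEta_tau, hh.rel, map_sub,
    map_sum, map_sum, sub_mul, Finset.sum_mul, Finset.sum_mul]
  congr 1
  · refine Finset.sum_congr rfl fun ν _ => ?_
    rw [tau_smul, substW_atW (E.homogeneous k ν j)]
    rcases lt_or_ge (E.d (k + 1) j - E.d k ν) 0 with he | he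
    · rw [eq_zero_of_mem_homPoly he (E.homogeneous k ν j), map_zero, map_zero, mul_zero,
        zero_mul, zero_mul, zero_smul]
    · -- the factor `α^(deg f)` produced by `f(αζ)` adjusts the exponent of `α`
      have hN : (κ - E.d k ν).toNat
          = (E.d (k + 1) j - E.d k ν).toNat + (κ - E.d (k + 1) j).toNat := by
        have := hκ (k + 1) j
        lia
      rw [hN, pow_add, smul_eq_fn_mul, alpha_pow_mul, mul_assoc (fn _), alpha_pow_mul,
        mul_assoc (fn _), ← mul_assoc (tau _), mul_assoc]
  · refine Finset.sum_congr rfl fun ν _ => ?_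
    rw [tau_smul, substW_atZ, tau_psgn, sgn_mul, map_pow (sgn (n := n)), sgn_alpha,
      smul_eq_fn_mul, mul_assoc]

/-- Both sides vanish: `H_0^ℓ = 0` for `ℓ > 0`, and `H_0^0` is diagonal with powers of `α`. -/
theorem nablaEta_heferOf_zero (hh : IsPolyHefer E h) (l : ℕ) (i : Fin (E.r l))
    (j : Fin (E.r 0)) : nablaEta (heferOf E κ h 0 l i j)
      = - ∑ ν, atZed (E.f l i ν) • sgn (heferOf E κ h 0 (l + 1) ν j) := by
  simp only [heferOf_of_lt hh l.succ_pos, Matrix.zero_apply, map_zero, smul_zero,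
    Finset.sum_const_zero, neg_zero]
  rcases l with _ | l
  · rw [heferOf_self hh]
    split_ifs
    · exact nablaEta_alpha_pow _
    · exact map_zero _
  · rw [heferOf_of_lt hh l.succ_pos, Matrix.zero_apply, map_zero]

end

end ProjHefer

end

theorem proposition4p4 (n : ℕ) (E : ProjHefer.LineComplex n) (κ : ℤ)
    (hκ : ∀ k j, E.d k j ≤ κ)
    (h : ∀ k l, Matrix (Fin (E.r l)) (Fin (E.r k)) (ProjHefer.PForm n))
    (hh : ProjHefer.IsPolyHefer E h) :
    ProjHefer.IsHefer (E.twist κ) (ProjHefer.heferOf E κ h) := by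
  constructor
  · intro k l i j
    exact ProjHefer.heferOf_mem_LL hκ hh k l i j
  · intro k l i j
    exact ProjHefer.holInZ_heferOf (E := E) k l i j
  · intro k l hkl
    exact ProjHefer.heferOf_of_lt hh hkl
  · intro l i j x hx
    exact ProjHefer.comp00_heferOf_diag hh l i j x hx
  · intro k l i j
    exact ProjHefer.nablaEta_heferOf_succ hκ hh k l i j
  · intro l i j
    exact ProjHefer.nablaEta_heferOf_zero hh l i j
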